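/- Let $n\ge 0$, let $\mathbb R^{n+1,1}$ be $\mathbb R^{n+2}$ with the form $\langle x,y\rangle=x_1y_1+\dots+x_{n+1}y_{n+1}-x_{n+2}y_{n+2}$, let $\mathbb H^{n+1}=\{x:\langle x,x\rangle=-1,\ x_{n+2}>0\}$ be hyperbolic space and $T^1\mathbb H^{n+1}=\{(x,v): x\in\mathbb H^{n+1},\ \langle x,v\rangle=0,\ \langle v,v\rangle=1\}$ its unit tangent bundle. Let $\mathcal G_{n+1}$ be the $2n$-dimensional manifold of maximal, oriented, unparametrized geodesics of $\mathbb H^{n+1}$, identified with the space $\partial\mathbb H^{n+1}\times\partial\mathbb H^{n+1}\setminus\Delta$ of ordered pairs of distinct points of the visual boundary, and let $\mathrm p:T^1\mathbb H^{n+1}\to\mathcal G_{n+1}$ send $(x,v)$ to the oriented geodesic through $x$ with velocity $v$; its fibres are the orbits of the geodesic flow, whose generator is $\chi_{(x,v)}=(v,x)$. Let $g$ be the para-Sasaki metric on $T^1\mathbb H^{n+1}$, that is, $g(u_1^{\mathcal H},u_2^{\mathcal H})=\langle u_1,u_2\rangle$ on horizontal lifts, $g(w_1^{\mathcal V},w_2^{\mathcal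 V})=-\langle w_1,w_2\rangle$ on vertical lifts, and horizontal and vertical vectors are $g$-orthogonal; let $J(\dot x,\dot v)=(\dot v,\dot x)$ on $\chi^\perp$. The differential $d\mathrm p$ restricts to an isomorphism $\chi^\perp_{(x,v)}\cong T_{\mathrm p(x,v)}\mathcal G_{n+1}$, which pushes $g$ and $J$ forward to a metric $\mathbb G$ and an endomorphism field $\mathbb J$ of $\mathcal G_{n+1}$, independently of the point of the fibre. The symplectic form of $\mathcal G_{n+1}$ is $\Omega(A,B)=\mathbb G(A,\mathbb J B)$. For an immersion $\sigma:U\to\mathbb H^{n+1}$ of an oriented $n$-manifold with unit normal field $\nu$ compatible with the orientations of $U$ and $\mathbb H^{n+1}$, the Gauss map of $\sigma$ is $G_\sigma=\mathrm p\circ(\sigma,\nu):U\to\mathcal G_{n+1}$. **Theorem.** Let $M$ be a smooth $n$-manifold and let $G:M\to\mathcal G_{n+1}$ be a smooth immersion. Then $G$ is Lagrangian, i.e. $G^*\Omega=0$, if and only if it is locally integrable, i.e. every point of $M$ has an open neighbourhood $U$ for which there are an orientation of $U$ and a smooth immersion $\sigma:U\to\mathbb H^{n+1}$ such that $G|_U$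 is the Gauss map $G_\sigma$ of $\sigma$ with respect to that orientation. -/

import Mathlib

open scoped Manifold ContDiff Topology

noncomputable section

namespace HypGeod

/-! ### Hyperbolic space and its unit tangent bundle in the hyperboloid model -/

/-- The vector space underlying Minkowski space `ℝ^{d,1}`; the last coordinate is timelike. -/
abbrev Minkowski (d : ℕ) : Type := Fin (d + 1) → ℝ

/-- The bilinear form `⟨x, y⟩ = x₁y₁ + … + x_d y_d - x_{d+1} y_{d+1}` of signature `(d, 1)`. -/
def lorentz (d : ℕ) : LinearMap.BilinForm ℝ (Minkowski d) :=
  LinearMap.mk₂ ℝ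
    (fun x y => ∑ i : Fin d, x i.castSucc * y i.castSucc - x (Fin.last d) * y (Fin.last d))
    (fun x y z => by simp [add_mul, Finset.sum_add_distrib]; ring)
    (fun c x y => by simp [mul_assoc, Finset.mul_sum, mul_sub])
    (fun x y z => by simp [mul_add, Finset.sum_add_distrib]; ring)
    (fun c x y => by simp [mul_left_comm, Finset.mul_sum, mul_sub])

/-- Hyperbolic space `ℍ^d ⊂ ℝ^{d,1}`. -/
def Hyp (d : ℕ) : Set (Minkowski d) :=
  {x | lorentz d x x = -1 ∧ 0 < x (Fin.last d)}

/-- The unit tangent bundle `T¹ℍ^d ⊂ ℝ^{d,1} × ℝ^{d,1}`, as the set of pairs `(x, v)`. -/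
def UnitTangent (d : ℕ) : Set (Minkowski d × Minkowski d) :=
  {ξ | ξ.1 ∈ Hyp d ∧ lorentz d ξ.1 ξ.2 = 0 ∧ lorentz d ξ.2 ξ.2 = 1}

/-- The geodesic flow `φ_t (x, v) = (γ(t), γ'(t))`. -/
def geodesicFlow {d : ℕ} (t : ℝ) (ξ : Minkowski d × Minkowski d) : Minkowski d × Minkowski d :=
  (Real.cosh t • ξ.1 + Real.sinh t • ξ.2, Real.sinh t • ξ.1 + Real.cosh t • ξ.2)

/-- The infinitesimal generator `χ_{(x,v)} = (v, x)` of the geodesic flow. -/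
def chi {d : ℕ} (ξ : Minkowski d × Minkowski d) : Minkowski d × Minkowski d := (ξ.2, ξ.1)

/-- The tangent space of `T¹ℍ^d` at `(x, v)`: the vectors `(ẋ, v̇)` with
`⟨x, ẋ⟩ = ⟨v, v̇⟩ = ⟨x, v̇⟩ + ⟨v, ẋ⟩ = 0`. -/
def tangentUT {d : ℕ} (ξ : UnitTangent d) : Submodule ℝ (Minkowski d × Minkowski d) where
  carrier := {X | lorentz d ξ.1.1 X.1 = 0 ∧ lorentz d ξ.1.2 X.2 = 0 ∧
    lorentz d ξ.1.1 X.2 + lorentz d ξ.1.2 X.1 = 0}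
  add_mem' := by
    rintro X Y ⟨h1, h2, h3⟩ ⟨k1, k2, k3⟩
    refine ⟨?_, ?_, ?_⟩ <;> simp only [Prod.fst_add, Prod.snd_add, map_add] <;> linarith
  zero_mem' := by simp
  smul_mem' := by
    rintro c X ⟨h1, h2, h3⟩
    refine ⟨?_, ?_, ?_⟩ <;> simp only [Prod.smul_fst, Prod.smul_snd, map_smul, smul_eq_mul]
    · rw [h1, mul_zero]
    · rw [h2, mul_zero]
    · rw [← mul_add, h3, mul_zero]

/-- The horizontal lift `u^ℋ ∈ T_{(x,v)}T¹ℍ^d` of `u ∈ T_xℍ^d`, i.e. the initial velocity of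
`(γ, V)` where `γ` is the geodesic with `γ'(0) = u` and `V` is the parallel field along `γ` with
`V(0) = v`. It is `(u, 0)` for `u ⊥ v`, and `(v, x)` for `u = v`. -/
def horizontalLift {d : ℕ} (ξ : UnitTangent d) (u : Minkowski d) : Minkowski d × Minkowski d :=
  (u, lorentz d u ξ.1.2 • ξ.1.1)

/-- The vertical lift `w^𝒱 = (0, w)` of `w ∈ T_xℍ^d` orthogonal to `v`. -/
def verticalLift {d : ℕ} (w : Minkowski d) : Minkowski d × Minkowski d := (0, w)

/-- The `w` in the decomposition `(ẋ, v̇) = ẋ^ℋ + w^𝒱`. -/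
def verticalPart {d : ℕ} (ξ : UnitTangent d) : Minkowski d × Minkowski d →ₗ[ℝ] Minkowski d :=
  LinearMap.snd ℝ _ _ - (((lorentz d).flip ξ.1.2).comp (LinearMap.fst ℝ _ _)).smulRight ξ.1.1

theorem eq_horizontalLift_add_verticalLift {d : ℕ} (ξ : UnitTangent d)
    (X : Minkowski d × Minkowski d) :
    X = horizontalLift ξ X.1 + verticalLift (verticalPart ξ X) := by
  ext i <;> simp [horizontalLift, verticalLift, verticalPart]

/-- The para-Sasaki metric: `⟨u₁, u₂⟩` on horizontal lifts, `-⟨w₁, w₂⟩` on vertical lifts, and the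
two distributions are orthogonal to each other. -/
def paraSasaki {d : ℕ} (ξ : UnitTangent d) : LinearMap.BilinForm ℝ (Minkowski d × Minkowski d) :=
  (lorentz d).compl₁₂ (LinearMap.fst ℝ _ _) (LinearMap.fst ℝ _ _) -
    (lorentz d).compl₁₂ (verticalPart ξ) (verticalPart ξ)

/-- The orthogonal complement `χ^⊥` of the generator of the geodesic flow in `T_{(x,v)}T¹ℍ^d`, for
the para-Sasaki metric. -/
def chiPerp {d : ℕ} (ξ : UnitTangent d) : Submodule ℝ (Minkowski d × Minkowski d) :=
  tangentUT ξ ⊓ LinearMap.ker ((paraSasaki ξ).flip (chi ξ.1))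

theorem lorentz_apply {d : ℕ} (x y : Minkowski d) :
    lorentz d x y
      = ∑ i : Fin d, x i.castSucc * y i.castSucc - x (Fin.last d) * y (Fin.last d) := rfl

theorem lorentz_comm {d : ℕ} (x y : Minkowski d) : lorentz d x y = lorentz d y x := by
  simp only [lorentz_apply, mul_comm]

theorem mem_chiPerp {d : ℕ} (ξ : UnitTangent d) (X : Minkowski d × Minkowski d) :
    X ∈ chiPerp ξ ↔ lorentz d ξ.1.1 X.1 = 0 ∧ lorentz d ξ.1.2 X.1 = 0 ∧
      lorentz d ξ.1.1 X.2 = 0 ∧ lorentz d ξ.1.2 X.2 = 0 := by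
  have hv : lorentz d ξ.1.2 ξ.1.2 = 1 := ξ.2.2.2
  have hg : (paraSasaki ξ) X (chi ξ.1) = lorentz d ξ.1.2 X.1 := by
    simp [paraSasaki, verticalPart, chi, hv, lorentz_comm ξ.1.2]
  rw [chiPerp, Submodule.mem_inf, LinearMap.mem_ker]
  change _ ∧ paraSasaki ξ X (chi ξ.1) = 0 ↔ _
  rw [hg]
  constructor
  · rintro ⟨⟨h1, h2, h3⟩, h4⟩
    exact ⟨h1, h4, by linarith, h2⟩
  · rintro ⟨h1, h2, h3, h4⟩
    exact ⟨⟨h1, h4, by rw [h2, h3, add_zero]⟩, h2⟩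

/-- The endomorphism `J (ẋ, v̇) = (v̇, ẋ)` of `χ^⊥`, so that `J w^ℋ = w^𝒱` and `J w^𝒱 = w^ℋ`. -/
def J {d : ℕ} (ξ : UnitTangent d) : chiPerp ξ →ₗ[ℝ] chiPerp ξ :=
  LinearMap.restrict (LinearMap.prod (LinearMap.snd ℝ _ _) (LinearMap.fst ℝ _ _)) (by
    intro X hX
    rw [mem_chiPerp] at hX ⊢
    obtain ⟨h1, h2, h3, h4⟩ := hX
    exact ⟨h3, h4, h1, h2⟩)

theorem J_coe {d : ℕ} (ξ : UnitTangent d) (X : chiPerp ξ) :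
    (J ξ X : Minkowski d × Minkowski d) = (X.1.2, X.1.1) := rfl

/-! ### The space of oriented geodesics -/

/-- The space of oriented geodesics of `ℍ^d`, as the space of ordered pairs of distinct points
`(ℓ₋, ℓ₊)` of the visual boundary. The boundary is the set of future null rays of `ℝ^{d,1}`, and
each ray is represented by its unique point whose last coordinate is `1`. It is an embedded
submanifold of `ℝ^{d,1} × ℝ^{d,1}`, and as such it is a smooth manifold. -/
def GeodesicSpace (d : ℕ) : Set (Minkowski d × Minkowski d) :=
  {ℓ | (lorentz d ℓ.1 ℓ.1 = 0 ∧ ℓ.1 (Fin.last d) = 1) ∧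
    (lorentz d ℓ.2 ℓ.2 = 0 ∧ ℓ.2 (Fin.last d) = 1) ∧ ℓ.1 ≠ ℓ.2}

/-- The tangent space of the space of oriented geodesics. -/
def tangentG {d : ℕ} (ℓ : GeodesicSpace d) : Submodule ℝ (Minkowski d × Minkowski d) where
  carrier := {A | (lorentz d ℓ.1.1 A.1 = 0 ∧ A.1 (Fin.last d) = 0) ∧
    (lorentz d ℓ.1.2 A.2 = 0 ∧ A.2 (Fin.last d) = 0)}
  add_mem' := by
    rintro X Y ⟨⟨h1, h2⟩, h3, h4⟩ ⟨⟨k1, k2⟩, k3, k4⟩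
    simp [h1, h2, h3, h4, k1, k2, k3, k4]
  zero_mem' := by simp
  smul_mem' := by
    rintro c X ⟨⟨h1, h2⟩, h3, h4⟩
    simp [h1, h2, h3, h4]

/-- The representative with last coordinate `1` of the ray through `y`. -/
def ray {d : ℕ} (y : Minkowski d) : Minkowski d := (y (Fin.last d))⁻¹ • y

/-- The two endpoints, at `t → -∞` and at `t → +∞`, of the geodesic
`t ↦ cosh t • x + sinh t • v`: these are the rays of `x - v` and `x + v`. -/
def endpoints {d : ℕ} (ξ : Minkowski d × Minkowski d) : Minkowski d × Minkowski d :=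
  (ray (ξ.1 - ξ.2), ray (ξ.1 + ξ.2))

theorem abs_time_lt {d : ℕ} {x v : Minkowski d} (h : (x, v) ∈ UnitTangent d) :
    |v (Fin.last d)| < x (Fin.last d) := by
  obtain ⟨⟨hx, hx0⟩, hxv, hv⟩ := h
  simp only [lorentz_apply] at hx hxv hv hx0
  have hcs := Finset.sum_mul_sq_le_sq_mul_sq Finset.univ
    (fun i : Fin d => x i.castSucc) (fun i : Fin d => v i.castSucc)
  simp only [pow_two] at hcs
  have e1 : ∑ i : Fin d, x i.castSucc * v i.castSucc = x (Fin.last d) * v (Fin.last d) := by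
    linarith
  have e2 : ∑ i : Fin d, x i.castSucc * x i.castSucc
      = x (Fin.last d) * x (Fin.last d) - 1 := by linarith
  have e3 : ∑ i : Fin d, v i.castSucc * v i.castSucc
      = v (Fin.last d) * v (Fin.last d) + 1 := by linarith
  rw [e1, e2, e3] at hcs
  have : v (Fin.last d) ^ 2 < x (Fin.last d) ^ 2 := by nlinarith
  exact abs_lt_of_sq_lt_sq this hx0.le

theorem time_sub_pos {d : ℕ} (ξ : UnitTangent d) : 0 < (ξ.1.1 - ξ.1.2) (Fin.last d) := by
  have := abs_lt.1 (abs_time_lt ξ.2)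
  simp only [Pi.sub_apply]
  linarith

theorem time_add_pos {d : ℕ} (ξ : UnitTangent d) : 0 < (ξ.1.1 + ξ.1.2) (Fin.last d) := by
  have := abs_lt.1 (abs_time_lt ξ.2)
  simp only [Pi.add_apply]
  linarith

theorem lorentz_relations {d : ℕ} (ξ : UnitTangent d) :
    lorentz d (ξ.1.1 - ξ.1.2) (ξ.1.1 - ξ.1.2) = 0 ∧
    lorentz d (ξ.1.1 + ξ.1.2) (ξ.1.1 + ξ.1.2) = 0 ∧
    lorentz d (ξ.1.1 - ξ.1.2) (ξ.1.1 + ξ.1.2) = -2 := by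
  obtain ⟨⟨hx, -⟩, hxv, hv⟩ := ξ.2
  have hvx := hxv
  rw [lorentz_comm] at hvx
  refine ⟨?_, ?_, ?_⟩ <;>
    simp only [map_add, map_sub, LinearMap.add_apply, LinearMap.sub_apply, hx, hxv, hv, hvx] <;>
    norm_num

theorem ray_last {d : ℕ} {y : Minkowski d} (h : 0 < y (Fin.last d)) : ray y (Fin.last d) = 1 := by
  simp [ray, h.ne']

theorem endpoints_mem {d : ℕ} (ξ : UnitTangent d) : endpoints ξ.1 ∈ GeodesicSpace d := by
  obtain ⟨h1, h2, h3⟩ := lorentz_relations ξ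
  have t1 := time_sub_pos ξ
  have t2 := time_add_pos ξ
  refine ⟨⟨?_, ray_last t1⟩, ⟨?_, ray_last t2⟩, fun h => ?_⟩
  · simp only [endpoints, ray, map_smul, LinearMap.smul_apply, h1, smul_zero]
  · simp only [endpoints, ray, map_smul, LinearMap.smul_apply, h2, smul_zero]
  · have e : lorentz d (ray (ξ.1.1 - ξ.1.2)) (ray (ξ.1.1 + ξ.1.2)) = 0 := by
      change ray (ξ.1.1 - ξ.1.2) = ray (ξ.1.1 + ξ.1.2) at h
      rw [← h]
      simp only [ray, map_smul, LinearMap.smul_apply, h1, smul_zero]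
    simp only [ray, map_smul, LinearMap.smul_apply, h3, smul_eq_mul] at e
    have := inv_pos.2 t1
    have := inv_pos.2 t2
    have := mul_pos (inv_pos.2 t1) (inv_pos.2 t2)
    nlinarith

/-- The bundle map `p : T¹ℍ^d → G_d`: `p (x, v)` is the oriented geodesic through `x` with
velocity `v`. -/
def p {d : ℕ} (ξ : UnitTangent d) : GeodesicSpace d := ⟨endpoints ξ.1, endpoints_mem ξ⟩

theorem lorentz_endpoints_neg {d : ℕ} (ℓ : GeodesicSpace d) : lorentz d ℓ.1.1 ℓ.1.2 < 0 := by
  obtain ⟨⟨b, a⟩, ⟨hb, hb1⟩, ⟨ha, ha1⟩, hne⟩ := ℓ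
  simp only [lorentz_apply] at ha hb ha1 hb1 hne ⊢
  rw [ha1] at ha ⊢
  rw [hb1] at hb ⊢
  by_contra hcon
  apply hne
  have hs : ∑ i : Fin d, (b i.castSucc - a i.castSucc) ^ 2 ≤ 0 := by
    have : ∑ i : Fin d, (b i.castSucc - a i.castSucc) ^ 2
        = ∑ i : Fin d, b i.castSucc * b i.castSucc + ∑ i : Fin d, a i.castSucc * a i.castSucc
          - 2 * ∑ i : Fin d, b i.castSucc * a i.castSucc := by
      rw [Finset.mul_sum, ← Finset.sum_add_distrib, ← Finset.sum_sub_distrib]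
      exact Finset.sum_congr rfl fun i _ => by ring
    linarith
  have hz := (Finset.sum_eq_zero_iff_of_nonneg (fun i _ => sq_nonneg _)).1
    (le_antisymm hs (Finset.sum_nonneg fun i _ => sq_nonneg (b (Fin.castSucc i) - a i.castSucc)))
  funext j
  refine Fin.lastCases ?_ (fun i => ?_) j
  · rw [ha1, hb1]
  · have := hz i (Finset.mem_univ i)
    exact sub_eq_zero.1 (pow_eq_zero_iff (two_ne_zero) |>.1 this)

/-- Every oriented geodesic has a unit tangent vector. -/
theorem p_surjective (d : ℕ) : Function.Surjective (p (d := d)) := by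
  intro ℓ
  have hm := lorentz_endpoints_neg ℓ
  obtain ⟨⟨b, a⟩, ⟨hb, hb1⟩, ⟨ha, ha1⟩, hne⟩ := ℓ
  simp only at hm hb ha hb1 ha1
  have hm' : lorentz d a b < 0 := by rwa [lorentz_comm]
  have hab : lorentz d a b = lorentz d b a := lorentz_comm a b
  set m := lorentz d b a with hmdef
  have hpos : 0 < 2 / (-m) := by apply div_pos <;> linarith
  set s := Real.sqrt (2 / (-m)) with hs
  have hs0 : 0 < s := Real.sqrt_pos.2 hpos
  have hs2 : s * s * m = -2 := by
    rw [hs, Real.mul_self_sqrt hpos.le]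
    have : m ≠ 0 := hm.ne
    field_simp
  have hmem : ((s / 2) • (a + b), (s / 2) • (a - b)) ∈ UnitTangent d := by
    refine ⟨⟨?_, ?_⟩, ?_, ?_⟩
    · simp only [map_smul, map_add, LinearMap.smul_apply, LinearMap.add_apply, ha, hb, hab,
        ← hmdef, smul_eq_mul]
      linarith
    · simp only [Pi.smul_apply, Pi.add_apply, ha1, hb1, smul_eq_mul]
      linarith
    · simp only [map_smul, map_add, map_sub, LinearMap.smul_apply, LinearMap.add_apply, ha, hb,
        hab, ← hmdef, smul_eq_mul]
      ring
    · simp only [map_smul, map_sub, LinearMap.smul_apply, LinearMap.sub_apply, ha, hb, hab,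
        ← hmdef, smul_eq_mul]
      linarith
  refine ⟨⟨_, hmem⟩, Subtype.ext ?_⟩
  have e1 : (s / 2) • (a + b) - (s / 2) • (a - b) = s • b := by
    ext i; simp; ring
  have e2 : (s / 2) • (a + b) + (s / 2) • (a - b) = s • a := by
    ext i; simp; ring
  change (ray ((s / 2) • (a + b) - (s / 2) • (a - b)),
    ray ((s / 2) • (a + b) + (s / 2) • (a - b))) = (b, a)
  rw [e1, e2, ray, ray]
  simp [ha1, hb1, smul_smul, hs0.ne']

theorem flow_add {d : ℕ} (t : ℝ) (ξ : Minkowski d × Minkowski d) :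
    (geodesicFlow t ξ).1 + (geodesicFlow t ξ).2 = Real.exp t • (ξ.1 + ξ.2) := by
  ext i
  simp [geodesicFlow, ← Real.cosh_add_sinh]
  ring

theorem flow_sub {d : ℕ} (t : ℝ) (ξ : Minkowski d × Minkowski d) :
    (geodesicFlow t ξ).1 - (geodesicFlow t ξ).2 = Real.exp (-t) • (ξ.1 - ξ.2) := by
  ext i
  simp [geodesicFlow, ← Real.cosh_sub_sinh]
  ring

theorem ray_smul {d : ℕ} {c : ℝ} (hc : c ≠ 0) (y : Minkowski d) : ray (c • y) = ray y := by
  simp only [ray, smul_smul, Pi.smul_apply, smul_eq_mul, mul_inv_rev]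
  rw [mul_assoc, inv_mul_cancel₀ hc, mul_one]

theorem endpoints_flow {d : ℕ} (t : ℝ) (ξ : Minkowski d × Minkowski d) :
    endpoints (geodesicFlow t ξ) = endpoints ξ := by
  rw [endpoints, endpoints, flow_add, flow_sub, ray_smul (Real.exp_pos _).ne',
    ray_smul (Real.exp_pos _).ne']

theorem eq_of_add_of_sub {d : ℕ} {ξ η : Minkowski d × Minkowski d}
    (h1 : ξ.1 + ξ.2 = η.1 + η.2) (h2 : ξ.1 - ξ.2 = η.1 - η.2) : ξ = η := by
  ext i
  · have := congrFun h1 i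
    have := congrFun h2 i
    simp only [Pi.add_apply, Pi.sub_apply] at *
    linarith
  · have := congrFun h1 i
    have := congrFun h2 i
    simp only [Pi.add_apply, Pi.sub_apply] at *
    linarith

/-- The fibres of `p` are exactly the orbits of the geodesic flow. -/
theorem p_eq_iff {d : ℕ} (ξ η : UnitTangent d) :
    p ξ = p η ↔ ∃ t : ℝ, η.1 = geodesicFlow t ξ.1 := by
  constructor
  · intro h
    have h' : endpoints ξ.1 = endpoints η.1 := congrArg Subtype.val h
    have hb : ray (ξ.1.1 - ξ.1.2) = ray (η.1.1 - η.1.2) := congrArg Prod.fst h'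
    have ha : ray (ξ.1.1 + ξ.1.2) = ray (η.1.1 + η.1.2) := congrArg Prod.snd h'
    have t1 := time_sub_pos ξ
    have t2 := time_add_pos ξ
    have k1 := time_sub_pos η
    have k2 := time_add_pos η
    have key : ∀ y z : Minkowski d, 0 < y (Fin.last d) → 0 < z (Fin.last d) → ray y = ray z →
        z = (z (Fin.last d) / y (Fin.last d)) • y := by
      intro y z hy hz hyz
      rw [div_eq_mul_inv, ← smul_smul]
      change z = z (Fin.last d) • ray y
      rw [hyz, ray, smul_smul, mul_inv_cancel₀ hz.ne', one_smul]
    have e1 := key _ _ t1 k1 hb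
    have e2 := key _ _ t2 k2 ha
    set r := (η.1.1 - η.1.2) (Fin.last d) / (ξ.1.1 - ξ.1.2) (Fin.last d)
    set s := (η.1.1 + η.1.2) (Fin.last d) / (ξ.1.1 + ξ.1.2) (Fin.last d) with hs
    have hs0 : 0 < s := div_pos k2 t2
    have hrs : r * s = 1 := by
      have a1 := (lorentz_relations η).2.2
      rw [e1, e2] at a1
      simp only [map_smul, LinearMap.smul_apply, (lorentz_relations ξ).2.2, smul_eq_mul] at a1
      linarith
    refine ⟨Real.log s, eq_of_add_of_sub ?_ ?_⟩
    · rw [flow_add, Real.exp_log hs0]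
      exact e2
    · rw [flow_sub, Real.exp_neg, Real.exp_log hs0, ← eq_inv_of_mul_eq_one_left hrs]
      exact e1
  · rintro ⟨t, ht⟩
    apply Subtype.ext
    change endpoints ξ.1 = endpoints η.1
    rw [ht, endpoints_flow]

/-! ### The differential of `p` -/

theorem hasFDerivAt_ray {d : ℕ} {y : Minkowski d} (hy : y (Fin.last d) ≠ 0) :
    ∃ L : Minkowski d →L[ℝ] Minkowski d, HasFDerivAt (ray (d := d)) L y ∧
      ∀ z, L z = (y (Fin.last d))⁻¹ • z - (z (Fin.last d) * (y (Fin.last d) ^ 2)⁻¹) • y := by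
  have h1 : HasFDerivAt (fun w : Minkowski d => w (Fin.last d))
      (ContinuousLinearMap.proj (R := ℝ) (φ := fun _ : Fin (d + 1) => ℝ) (Fin.last d)) y :=
    (ContinuousLinearMap.proj (R := ℝ) (φ := fun _ : Fin (d + 1) => ℝ) (Fin.last d)).hasFDerivAt
  have h2 := (hasDerivAt_inv hy).comp_hasFDerivAt y h1
  have h3 := h2.smul (hasFDerivAt_id y)
  refine ⟨_, h3, fun z => ?_⟩
  ext i
  simp
  ring

theorem hasFDerivAt_endpoints {d : ℕ} (ξ : UnitTangent d) :
    ∃ L : Minkowski d × Minkowski d →L[ℝ] Minkowski d × Minkowski d,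
      HasFDerivAt (endpoints (d := d)) L ξ.1 ∧
      ∀ X, L X =
        (((ξ.1.1 - ξ.1.2) (Fin.last d))⁻¹ • (X.1 - X.2) - ((X.1 - X.2) (Fin.last d) *
          ((ξ.1.1 - ξ.1.2) (Fin.last d) ^ 2)⁻¹) • (ξ.1.1 - ξ.1.2),
        ((ξ.1.1 + ξ.1.2) (Fin.last d))⁻¹ • (X.1 + X.2) - ((X.1 + X.2) (Fin.last d) *
          ((ξ.1.1 + ξ.1.2) (Fin.last d) ^ 2)⁻¹) • (ξ.1.1 + ξ.1.2)) := by
  obtain ⟨L1, hL1, e1⟩ := hasFDerivAt_ray (time_sub_pos ξ).ne'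
  obtain ⟨L2, hL2, e2⟩ := hasFDerivAt_ray (time_add_pos ξ).ne'
  have hs := (hasFDerivAt_fst (𝕜 := ℝ) (p := ξ.1)).sub (hasFDerivAt_snd (𝕜 := ℝ) (p := ξ.1))
  have ha := (hasFDerivAt_fst (𝕜 := ℝ) (p := ξ.1)).add (hasFDerivAt_snd (𝕜 := ℝ) (p := ξ.1))
  refine ⟨_, (HasFDerivAt.comp ξ.1 hL1 hs).prodMk (HasFDerivAt.comp ξ.1 hL2 ha), fun X => ?_⟩
  rw [← e1, ← e2]
  rfl

theorem fderiv_endpoints {d : ℕ} (ξ : UnitTangent d) (X : Minkowski d × Minkowski d) :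
    fderiv ℝ (endpoints (d := d)) ξ.1 X =
      (((ξ.1.1 - ξ.1.2) (Fin.last d))⁻¹ • (X.1 - X.2) - ((X.1 - X.2) (Fin.last d) *
        ((ξ.1.1 - ξ.1.2) (Fin.last d) ^ 2)⁻¹) • (ξ.1.1 - ξ.1.2),
      ((ξ.1.1 + ξ.1.2) (Fin.last d))⁻¹ • (X.1 + X.2) - ((X.1 + X.2) (Fin.last d) *
        ((ξ.1.1 + ξ.1.2) (Fin.last d) ^ 2)⁻¹) • (ξ.1.1 + ξ.1.2)) := by
  obtain ⟨L, hL, e⟩ := hasFDerivAt_endpoints ξ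
  rw [hL.fderiv, e]

theorem fderiv_endpoints_mem {d : ℕ} (ξ : UnitTangent d) {X : Minkowski d × Minkowski d}
    (hX : X ∈ tangentUT ξ) : fderiv ℝ (endpoints (d := d)) ξ.1 X ∈ tangentG (p ξ) := by
  have t1 := (time_sub_pos ξ).ne'
  have t2 := (time_add_pos ξ).ne'
  obtain ⟨r1, r2, -⟩ := lorentz_relations ξ
  obtain ⟨h1, h2, h3⟩ := hX
  have o1 : lorentz d (ξ.1.1 - ξ.1.2) (X.1 - X.2) = 0 := by
    simp only [map_sub, LinearMap.sub_apply]
    linarith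
  have o2 : lorentz d (ξ.1.1 + ξ.1.2) (X.1 + X.2) = 0 := by
    simp only [map_add, LinearMap.add_apply]
    linarith
  have key : ∀ y z : Minkowski d, y (Fin.last d) ≠ 0 → ((y (Fin.last d))⁻¹ • z -
      (z (Fin.last d) * (y (Fin.last d) ^ 2)⁻¹) • y) (Fin.last d) = 0 := by
    intro y z hy
    simp only [Pi.sub_apply, Pi.smul_apply, smul_eq_mul]
    field_simp
    ring
  have key2 : ∀ (y z : Minkowski d) (a b c : ℝ), lorentz d y y = 0 → lorentz d y z = 0 →
      lorentz d (c • y) (a • z - b • y) = 0 := by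
    intro y z a b c hy hz
    simp only [map_sub, map_smul, LinearMap.smul_apply, hy, hz, smul_zero, sub_self]
  rw [fderiv_endpoints]
  refine ⟨⟨?_, ?_⟩, ?_, ?_⟩
  · change lorentz d (ray (ξ.1.1 - ξ.1.2)) _ = 0
    exact key2 _ _ _ _ _ r1 o1
  · exact key _ _ t1
  · change lorentz d (ray (ξ.1.1 + ξ.1.2)) _ = 0
    exact key2 _ _ _ _ _ r2 o2
  · exact key _ _ t2

/-- The differential `dp : T_{(x,v)}T¹ℍ^d → T_ℓ G_d` of `p` at a point `(x, v)` of the fibre over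
`ℓ`. -/
def dp {d : ℕ} (ξ : UnitTangent d) {ℓ : GeodesicSpace d} (h : p ξ = ℓ) :
    tangentUT ξ →ₗ[ℝ] tangentG ℓ :=
  LinearMap.restrict (fderiv ℝ (endpoints (d := d)) ξ.1).toLinearMap
    (fun _ hX => h ▸ fderiv_endpoints_mem ξ hX)

/-- The restriction of `dp` to `χ^⊥`. -/
def dpPerp {d : ℕ} (ξ : UnitTangent d) {ℓ : GeodesicSpace d} (h : p ξ = ℓ) :
    chiPerp ξ →ₗ[ℝ] tangentG ℓ :=
  (dp ξ h).comp (Submodule.inclusion inf_le_left)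

theorem dpPerp_coe {d : ℕ} (ξ : UnitTangent d) {ℓ : GeodesicSpace d} (h : p ξ = ℓ)
    (X : chiPerp ξ) : (dpPerp ξ h X : Minkowski d × Minkowski d)
      = fderiv ℝ (endpoints (d := d)) ξ.1 X.1 := rfl

theorem dpPerp_bijective {d : ℕ} (ξ : UnitTangent d) {ℓ : GeodesicSpace d} (h : p ξ = ℓ) :
    Function.Bijective (dpPerp ξ h) := by
  subst h
  have t1 := (time_sub_pos ξ).ne'
  have t2 := (time_add_pos ξ).ne'
  obtain ⟨r1, r2, r3⟩ := lorentz_relations ξ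
  have r3' := r3
  rw [lorentz_comm] at r3'
  constructor
  · rw [← LinearMap.ker_eq_bot, LinearMap.ker_eq_bot']
    intro X hX
    obtain ⟨h1, h2, h3, h4⟩ := (mem_chiPerp ξ X.1).1 X.2
    have hX' : fderiv ℝ (endpoints (d := d)) ξ.1 X.1 = 0 := by
      rw [← dpPerp_coe ξ rfl X, hX]
      rfl
    rw [fderiv_endpoints, Prod.mk_eq_zero] at hX'
    obtain ⟨k1, k2⟩ := hX'
    have key : ∀ (y z u : Minkowski d) (c : ℝ), y (Fin.last d) ≠ 0 →
        (y (Fin.last d))⁻¹ • z - c • y = 0 → lorentz d u z = 0 → lorentz d u y ≠ 0 → z = 0 := by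
      intro y z u c hy e hz hyu
      have e2 := congrArg (lorentz d u) e
      simp only [map_sub, map_smul, hz, smul_eq_mul, mul_zero, zero_sub, map_zero, neg_eq_zero,
        mul_eq_zero, hyu, or_false] at e2
      rw [e2, zero_smul, sub_zero] at e
      exact (smul_eq_zero.1 e).resolve_left (inv_ne_zero hy)
    have z1 : X.1.1 - X.1.2 = 0 := key _ _ (ξ.1.1 + ξ.1.2) _ t1 k1
      (by simp only [map_add, map_sub, LinearMap.add_apply, h1, h2, h3, h4]; norm_num)
      (by rw [r3']; norm_num)
    have z2 : X.1.1 + X.1.2 = 0 := key _ _ (ξ.1.1 - ξ.1.2) _ t2 k2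
      (by simp only [map_add, map_sub, LinearMap.sub_apply, h1, h2, h3, h4]; norm_num)
      (by rw [r3]; norm_num)
    apply Subtype.ext
    exact eq_of_add_of_sub (by simpa using z2) (by simpa using z1)
  · rintro ⟨⟨B, A⟩, ⟨hB, hB0⟩, hA, hA0⟩
    change lorentz d (ray (ξ.1.1 - ξ.1.2)) B = 0 at hB
    change lorentz d (ray (ξ.1.1 + ξ.1.2)) A = 0 at hA
    rw [ray, LinearMap.map_smul₂, smul_eq_mul, mul_eq_zero, or_iff_right (inv_ne_zero t1)] at hB
    rw [ray, LinearMap.map_smul₂, smul_eq_mul, mul_eq_zero, or_iff_right (inv_ne_zero t2)] at hA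
    simp only at hB0 hA0
    set y := ξ.1.1 - ξ.1.2 with hy
    set z := ξ.1.1 + ξ.1.2 with hz
    set Q : Minkowski d := y (Fin.last d) • B + (y (Fin.last d) * lorentz d z B / 2) • y with hQ
    set P : Minkowski d := z (Fin.last d) • A + (z (Fin.last d) * lorentz d y A / 2) • z with hP
    have q1 : lorentz d y Q = 0 := by rw [hQ]; simp [hB, r1]
    have q2 : lorentz d z Q = 0 := by rw [hQ]; simp [r3']
    have p1 : lorentz d y P = 0 := by rw [hP]; simp [r3]
    have p2 : lorentz d z P = 0 := by rw [hP]; simp [hA, r2]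
    have ex : ξ.1.1 = (1 / 2 : ℝ) • (z + y) := by ext i; simp [hy, hz]; ring
    have ev : ξ.1.2 = (1 / 2 : ℝ) • (z - y) := by ext i; simp [hy, hz]; ring
    have hmem : ((1 / 2 : ℝ) • (P + Q), (1 / 2 : ℝ) • (P - Q)) ∈ chiPerp ξ := by
      rw [mem_chiPerp, ex, ev]
      simp [q1, q2, p1, p2]
    refine ⟨⟨_, hmem⟩, Subtype.ext ?_⟩
    rw [dpPerp_coe, fderiv_endpoints]
    have s1 : (1 / 2 : ℝ) • (P + Q) - (1 / 2 : ℝ) • (P - Q) = Q := by ext i; simp; ring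
    have s2 : (1 / 2 : ℝ) • (P + Q) + (1 / 2 : ℝ) • (P - Q) = P := by ext i; simp; ring
    simp only [s1, s2, ← hy, ← hz]
    refine Prod.ext ?_ ?_
    · ext i
      simp [hQ, hB0]
      field_simp
      ring
    · ext i
      simp [hP, hA0]
      field_simp
      ring

/-- The isomorphism `dp : χ^⊥_{(x,v)} ≃ T_ℓ G_d`. -/
def dpEquiv {d : ℕ} (ξ : UnitTangent d) {ℓ : GeodesicSpace d} (h : p ξ = ℓ) :
    chiPerp ξ ≃ₗ[ℝ] tangentG ℓ :=
  LinearEquiv.ofBijective (dpPerp ξ h) (dpPerp_bijective ξ h)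

/-! ### The para-Kähler structure of the space of oriented geodesics -/

/-- A point of `T¹ℍ^d` in the fibre of `p` over `ℓ`. -/
def point {d : ℕ} (ℓ : GeodesicSpace d) : UnitTangent d := (p_surjective d ℓ).choose

theorem p_point {d : ℕ} (ℓ : GeodesicSpace d) : p (point ℓ) = ℓ := (p_surjective d ℓ).choose_spec

/-- The neutral metric of `G_d`: the push-forward of the para-Sasaki metric on `χ^⊥`. -/
def neutralMetric {d : ℕ} (ℓ : GeodesicSpace d) : LinearMap.BilinForm ℝ (tangentG ℓ) :=
  (paraSasaki (point ℓ)).compl₁₂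
    ((chiPerp (point ℓ)).subtype.comp (dpEquiv (point ℓ) (p_point ℓ)).symm.toLinearMap)
    ((chiPerp (point ℓ)).subtype.comp (dpEquiv (point ℓ) (p_point ℓ)).symm.toLinearMap)

/-- The para-complex structure of `G_d`: the push-forward of `J`. -/
def paraComplex {d : ℕ} (ℓ : GeodesicSpace d) : tangentG ℓ →ₗ[ℝ] tangentG ℓ :=
  (dpEquiv (point ℓ) (p_point ℓ)).toLinearMap.comp
    ((J (point ℓ)).comp (dpEquiv (point ℓ) (p_point ℓ)).symm.toLinearMap)

/-- The symplectic form `Ω(A, B) = 𝔾(A, 𝕁 B)` of `G_d`. -/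
def Omega {d : ℕ} (ℓ : GeodesicSpace d) : LinearMap.BilinForm ℝ (tangentG ℓ) :=
  (neutralMetric ℓ).compl₁₂ LinearMap.id (paraComplex ℓ)

theorem paraSasaki_chiPerp {d : ℕ} (ξ : UnitTangent d) (X Y : chiPerp ξ) :
    paraSasaki ξ X.1 Y.1 = lorentz d X.1.1 Y.1.1 - lorentz d X.1.2 Y.1.2 := by
  obtain ⟨-, h2, -, -⟩ := (mem_chiPerp ξ X.1).1 X.2
  obtain ⟨-, k2, -, -⟩ := (mem_chiPerp ξ Y.1).1 Y.2
  rw [lorentz_comm] at h2 k2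
  simp [paraSasaki, verticalPart, h2, k2]

/-- `Ω` does not depend on the point chosen in the fibre of `p`. -/
theorem Omega_eq {d : ℕ} (ξ : UnitTangent d) {ℓ : GeodesicSpace d} (h : p ξ = ℓ)
    (X Y : chiPerp ξ) :
    Omega ℓ (dpEquiv ξ h X) (dpEquiv ξ h Y) = paraSasaki ξ X.1 (J ξ Y).1 := by
  obtain ⟨t, ht⟩ := (p_eq_iff ξ (point ℓ)).1 (h.trans (p_point ℓ).symm)
  have hmem : ∀ Z : chiPerp ξ, geodesicFlow t Z.1 ∈ chiPerp (point ℓ) := by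
    intro Z
    obtain ⟨h1, h2, h3, h4⟩ := (mem_chiPerp ξ Z.1).1 Z.2
    rw [mem_chiPerp, ht]
    simp [geodesicFlow, h1, h2, h3, h4]
  let F : Minkowski d × Minkowski d →ₗ[ℝ] Minkowski d × Minkowski d :=
    { toFun := geodesicFlow t
      map_add' := fun a b => by ext i <;> simp [geodesicFlow] <;> ring
      map_smul' := fun c a => by ext i <;> simp [geodesicFlow] <;> ring }
  have hd : ∀ Z : chiPerp ξ,
      dpEquiv (point ℓ) (p_point ℓ) ⟨_, hmem Z⟩ = dpEquiv ξ h Z := by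
    intro Z
    apply Subtype.ext
    change fderiv ℝ (endpoints (d := d)) (point ℓ).1 (geodesicFlow t Z.1)
      = fderiv ℝ (endpoints (d := d)) ξ.1 Z.1
    obtain ⟨L, hL, -⟩ := hasFDerivAt_endpoints (point ℓ)
    have hF : HasFDerivAt (geodesicFlow (d := d) t) F.toContinuousLinearMap ξ.1 :=
      F.toContinuousLinearMap.hasFDerivAt
    have hL' := hL
    rw [ht] at hL'
    have hc := HasFDerivAt.comp ξ.1 hL' hF
    have he : endpoints (d := d) ∘ geodesicFlow t = endpoints := by
      funext η
      exact endpoints_flow t η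
    rw [he] at hc
    rw [hL.fderiv, hc.fderiv]
    rfl
  have hX : (dpEquiv (point ℓ) (p_point ℓ)).symm (dpEquiv ξ h X) = ⟨_, hmem X⟩ := by
    rw [← hd X, LinearEquiv.symm_apply_apply]
  have hY : (dpEquiv (point ℓ) (p_point ℓ)).symm (dpEquiv ξ h Y) = ⟨_, hmem Y⟩ := by
    rw [← hd Y, LinearEquiv.symm_apply_apply]
  have e : Omega ℓ (dpEquiv ξ h X) (dpEquiv ξ h Y)
      = paraSasaki (point ℓ) (⟨_, hmem X⟩ : chiPerp (point ℓ)).1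
        (J (point ℓ) ⟨_, hmem Y⟩).1 := by
    simp only [Omega, neutralMetric, paraComplex, LinearMap.compl₁₂_apply, LinearMap.comp_apply,
      LinearEquiv.coe_coe, LinearEquiv.symm_apply_apply, LinearMap.id_apply, hX, hY,
      Submodule.subtype_apply]
  rw [e, paraSasaki_chiPerp, paraSasaki_chiPerp]
  have hcs := Real.cosh_sq t
  simp only [J_coe, geodesicFlow, map_add, map_smul, LinearMap.add_apply, LinearMap.smul_apply,
    smul_eq_mul]
  linear_combination
    (lorentz d X.1.1 Y.1.2 - lorentz d X.1.2 Y.1.1) * hcs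

/-! ### Immersions, orientations and Gauss maps -/

section Manifold

variable {n d : ℕ} {N : Type*} [TopologicalSpace N] [ChartedSpace (EuclideanSpace ℝ (Fin n)) N]

/-- A map from an `n`-manifold to a finite-dimensional vector space (in practice: to an embedded
submanifold of it) is an immersion if it is smooth with injective differential everywhere. -/
def IsSmoothImmersion {V : Type*} [NormedAddCommGroup V] [NormedSpace ℝ V] (f : N → V) : Prop :=
  ContMDiff (𝓡 n) 𝓘(ℝ, V) ∞ f ∧ ∀ q, Function.Injective (mfderiv (𝓡 n) 𝓘(ℝ, V) f q)

/-- An immersion of an `n`-manifold into `ℍ^d`. -/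
def IsImmersionHyp (σ : N → Hyp d) : Prop :=
  IsSmoothImmersion (n := n) (fun q => (σ q : Minkowski d))

/-- An immersion of an `n`-manifold into the space of oriented geodesics `G_d`. -/
def IsImmersionG (G : N → GeodesicSpace d) : Prop :=
  IsSmoothImmersion (n := n) (fun q => (G q : Minkowski d × Minkowski d))

theorem mfderiv_mem_tangentG (G : N → GeodesicSpace d) (q : N) (u : TangentSpace (𝓡 n) q) :
    (mfderiv (𝓡 n) 𝓘(ℝ, Minkowski d × Minkowski d)
      (fun q => (G q : Minkowski d × Minkowski d)) q u : Minkowski d × Minkowski d)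
      ∈ tangentG (G q) := by
  by_cases hG : MDifferentiableAt (𝓡 n) 𝓘(ℝ, Minkowski d × Minkowski d)
      (fun q => (G q : Minkowski d × Minkowski d)) q
  swap
  · rw [mfderiv_zero_of_not_mdifferentiableAt hG]
    exact (tangentG (G q)).zero_mem
  have key : ∀ (Φ : Minkowski d × Minkowski d → ℝ)
      (L : Minkowski d × Minkowski d →L[ℝ] ℝ) (c : ℝ), HasFDerivAt Φ L (G q).1 →
      (∀ r : N, Φ (G r).1 = c) →
      L (mfderiv (𝓡 n) 𝓘(ℝ, Minkowski d × Minkowski d)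
        (fun q => (G q : Minkowski d × Minkowski d)) q u) = 0 := by
    intro Φ L c hΦ hc
    have h1 := HasMFDerivAt.comp q hΦ.hasMFDerivAt hG.hasMFDerivAt
    have h2 : (Φ ∘ fun q => (G q : Minkowski d × Minkowski d)) = fun _ => c := funext hc
    rw [h2] at h1
    have h3 := hasMFDerivAt_unique h1 (hasMFDerivAt_const c q)
    exact congrArg (fun T => T u) h3
  have hB := (lorentz d).toContinuousBilinearMap.isBoundedBilinearMap
  have hq : ∀ T : Minkowski d × Minkowski d →L[ℝ] Minkowski d,
      (∀ r : N, lorentz d (T (G r).1) (T (G r).1) = 0) →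
      lorentz d (T (G q).1) (T (mfderiv (𝓡 n) 𝓘(ℝ, Minkowski d × Minkowski d)
        (fun q => (G q : Minkowski d × Minkowski d)) q u)) = 0 := by
    intro T hT
    have h1 := HasFDerivAt.comp (G q).1 (hB.hasFDerivAt (T (G q).1, T (G q).1))
      (T.prod T).hasFDerivAt
    have h2 := key _ _ 0 h1 hT
    have h3 : ∀ A : Minkowski d × Minkowski d,
        ((hB.deriv (T (G q).1, T (G q).1)).comp (T.prod T)) A
          = lorentz d (T (G q).1) (T A) + lorentz d (T A) (T (G q).1) := fun A => rfl
    have h4 : ∀ a b : Minkowski d, lorentz d a b + lorentz d b a = 0 → lorentz d a b = 0 := by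
      intro a b hab
      rw [lorentz_comm b a] at hab
      linarith
    exact h4 _ _ ((h3 _).symm.trans h2)
  have hl : ∀ T : Minkowski d × Minkowski d →L[ℝ] ℝ, (∀ r : N, T (G r).1 = 1) →
      T (mfderiv (𝓡 n) 𝓘(ℝ, Minkowski d × Minkowski d)
        (fun q => (G q : Minkowski d × Minkowski d)) q u) = 0 :=
    fun T hT => key T T 1 T.hasFDerivAt hT
  refine ⟨⟨?_, ?_⟩, ?_, ?_⟩
  · exact hq (ContinuousLinearMap.fst ℝ _ _) fun r => (G r).2.1.1
  · exact hl ((ContinuousLinearMap.proj (R := ℝ) (φ := fun _ : Fin (d + 1) => ℝ)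
      (Fin.last d)).comp (ContinuousLinearMap.fst ℝ _ _)) fun r => (G r).2.1.2
  · exact hq (ContinuousLinearMap.snd ℝ _ _) fun r => (G r).2.2.1.1
  · exact hl ((ContinuousLinearMap.proj (R := ℝ) (φ := fun _ : Fin (d + 1) => ℝ)
      (Fin.last d)).comp (ContinuousLinearMap.snd ℝ _ _)) fun r => (G r).2.2.1.2

/-- The differential `dG : T_qN → T_{G(q)}G_d` of a map into the space of oriented geodesics. -/
def dG (G : N → GeodesicSpace d) (q : N) : TangentSpace (𝓡 n) q →ₗ[ℝ] tangentG (G q) :=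
  LinearMap.codRestrict (tangentG (G q))
    (mfderiv (𝓡 n) 𝓘(ℝ, Minkowski d × Minkowski d)
      (fun q => (G q : Minkowski d × Minkowski d)) q).toLinearMap
    (mfderiv_mem_tangentG G q)

/-- `G^*Ω = 0`. An immersion of an `n`-manifold into the `2n`-dimensional manifold `G_{n+1}` is
Lagrangian when this holds. -/
def IsLagrangian (G : N → GeodesicSpace (n + 1)) : Prop :=
  ∀ (q : N) (u w : TangentSpace (𝓡 n) q), Omega (G q) (dG G q u) (dG G q w) = 0

variable (n N) in
/-- An orientation of an `n`-manifold: an orientation of each tangent space, which in the chart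
around any point is given near that point by a constant `n`-form of `ℝ^n`. -/
structure ManifoldOrientation where
  orient : ∀ q : N, Orientation ℝ (TangentSpace (𝓡 n) q) (Fin n)
  locally_const : ∀ q₀ : N, ∃ α : EuclideanSpace ℝ (Fin n) [⋀^Fin n]→ₗ[ℝ] ℝ,
    ∀ᶠ q in 𝓝 q₀, ∃ h : α.compLinearMap (mfderiv (𝓡 n) 𝓘(ℝ, EuclideanSpace ℝ (Fin n))
      (extChartAt (𝓡 n) q₀) q).toLinearMap ≠ 0, orient q = rayOfNeZero ℝ _ h

/-- The `n`-form `(u₁, …, u_n) ↦ det (σ(q), v, dσ u₁, …, dσ u_n)` on `T_qN`. Here `ℍ^{n+1}` is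
oriented by `(w₀, …, w_n) ↦ det (x, w₀, …, w_n)` on `T_xℍ^{n+1}`. -/
def normalForm (σ : N → Hyp (n + 1)) (q : N) (v : Minkowski (n + 1)) :
    TangentSpace (𝓡 n) q [⋀^Fin n]→ₗ[ℝ] ℝ :=
  (((Matrix.detRowAlternating (R := ℝ) (n := Fin (n + 2))).curryLeft
    (σ q : Minkowski (n + 1))).curryLeft v).compLinearMap
      (mfderiv (𝓡 n) 𝓘(ℝ, Minkowski (n + 1)) (fun q => (σ q : Minkowski (n + 1))) q).toLinearMap

/-- `ν` is the unit normal vector field of `σ` compatible with the orientation `o` of `N` and the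
orientation of `ℍ^{n+1}`: it is tangent to `ℍ^{n+1}`, of unit length, orthogonal to the image of
`dσ`, and `(ν, dσ u₁, …, dσ u_n)` is a positive basis if `(u₁, …, u_n)` is. -/
def IsCompatibleNormal (o : ManifoldOrientation n N) (σ : N → Hyp (n + 1))
    (ν : N → Minkowski (n + 1)) : Prop :=
  ∀ q : N, ((σ q : Minkowski (n + 1)), ν q) ∈ UnitTangent (n + 1) ∧
    (∀ u : TangentSpace (𝓡 n) q, lorentz (n + 1) (ν q)
      (mfderiv (𝓡 n) 𝓘(ℝ, Minkowski (n + 1)) (fun q => (σ q : Minkowski (n + 1))) q u) = 0) ∧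
    ∃ h : normalForm σ q (ν q) ≠ 0, o.orient q = rayOfNeZero ℝ _ h

/-- `G` is the Gauss map `G_σ = p ∘ ζ_σ` of `σ`, where `ζ_σ = (σ, ν)` is the lift of `σ` by its
unit normal vector field `ν` compatible with the orientations. -/
def IsGaussMap (o : ManifoldOrientation n N) (σ : N → Hyp (n + 1))
    (G : N → GeodesicSpace (n + 1)) : Prop :=
  ∃ (ν : N → Minkowski (n + 1)) (hν : IsCompatibleNormal o σ ν),
    ∀ q : N, G q = p ⟨((σ q : Minkowski (n + 1)), ν q), (hν q).1⟩

/-- Every point has an open neighbourhood `U` such that `G|_U` is the Gauss map of an immersion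
`U → ℍ^{n+1}`, with respect to some orientation of `U`. -/
def IsLocallyIntegrable (G : N → GeodesicSpace (n + 1)) : Prop :=
  ∀ q : N, ∃ U : TopologicalSpace.Opens N, q ∈ U ∧
    ∃ (o : ManifoldOrientation n U) (σ : U → Hyp (n + 1)),
      IsImmersionHyp (n := n) σ ∧ IsGaussMap o σ (fun r : U => G r)

end Manifold

end HypGeod
end

noncomputable section

namespace HypGeod

/-! ### Linear algebra of Minkowski space -/

/-! The proof rests on the tautological `1`-form `θ = ⟨v, dx⟩` of the unit tangent bundle. For
arbitrary lifts of tangent vectors, the pull-back of `Ω` by `p` is `⟨ẋ₁, v̇₂⟩ - ⟨v̇₁, ẋ₂⟩`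
(`Omega_lift`), which is `-dθ` (`hasFDerivAt_tautological`). So a map into the space of geodesics is
Lagrangian exactly when its local lifts `(X, V)` pull `θ` back to closed forms. For the lift `(σ,
ν)` of an immersion, normality of `ν` says that this pull-back is zero, hence closed: Gauss maps are
Lagrangian (`isLagrangian_of_isGaussMap`).

Conversely, `unitLift` gives a smooth lift of `G` over a ball in a chart. There the closed form `⟨V,
dX⟩` is some `df`. Moving the lift by the geodesic flow for a variable time `F` leaves the geodesics
unchanged and adds `dF` to the form, so `F = -f + const` makes the new `V₁` normal to `dX₁`
(`exists_normal_lift`).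

It remains to choose the constant so that `X₁` is an immersion at the centre. At a bad time `t` some
nonzero `u` is killed by `cosh t • A + sinh t • B`, where `(A, B)` is the differential of the lift
projected to `χ^⊥`. The Lagrangian condition makes the vectors `B u` for distinct bad times
orthogonal, and they are nonzero and spacelike. Finite dimension therefore excludes that every time
is bad (`exists_flow_injective`). Injectivity of the differential is an open condition, so `X₁` is
an immersion near the centre, and `det (σ, ν, dσ ·)` provides the orientation (`normalForm_ne_zero`,
`exists_orientation`). -/

theorem lorentz_self_pos {d : ℕ} {x y : Minkowski d} (hx : x ∈ Hyp d) (hxy : lorentz d x y = 0)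
    (hy : y ≠ 0) : 0 < lorentz d y y := by
  obtain ⟨hx, hx0⟩ := hx
  simp only [lorentz_apply] at hx hxy hx0 ⊢
  -- With `x₀`, `y₀` the last coordinates and `S` the spatial square norm of `y`, Cauchy–Schwarz
  -- becomes `x₀² y₀² ≤ (x₀² - 1) S`, that is, `S ≤ x₀² (S - y₀²)`.
  have hcs := Finset.sum_mul_sq_le_sq_mul_sq Finset.univ
    (fun i : Fin d => x i.castSucc) (fun i : Fin d => y i.castSucc)
  simp only [pow_two] at hcs
  set S := ∑ i : Fin d, y i.castSucc * y i.castSucc with hS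
  have e1 : ∑ i : Fin d, x i.castSucc * y i.castSucc = x (Fin.last d) * y (Fin.last d) := by
    linarith
  have e2 : ∑ i : Fin d, x i.castSucc * x i.castSucc
      = x (Fin.last d) * x (Fin.last d) - 1 := by linarith
  rw [e1, e2] at hcs
  have hS0 : 0 ≤ S := Finset.sum_nonneg fun i _ => mul_self_nonneg _
  have hSpos : 0 < S := by
    refine lt_of_le_of_ne hS0 fun h0 => hy ?_
    have hz := (Finset.sum_eq_zero_iff_of_nonneg
      (fun i _ => mul_self_nonneg (y (Fin.castSucc i)))).1 h0.symm
    have hz' : ∀ i : Fin d, y i.castSucc = 0 := fun i =>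
      mul_self_eq_zero.1 (hz i (Finset.mem_univ i))
    funext j
    refine Fin.lastCases ?_ hz' j
    simp only [hz', mul_zero, Finset.sum_const_zero] at e1
    exact (mul_eq_zero.1 e1.symm).resolve_left hx0.ne'
  nlinarith [mul_pos hx0 hx0]

/-- The Lorentz form as a continuous bilinear map. -/
def lorentzL (d : ℕ) : Minkowski d →L[ℝ] Minkowski d →L[ℝ] ℝ :=
  (lorentz d).toContinuousBilinearMap

theorem lorentzL_apply {d : ℕ} (x y : Minkowski d) : lorentzL d x y = lorentz d x y := rfl

/-- The endpoints are constant along the geodesic flow, and `chi` is its velocity. This is what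
makes `Ω` computable from lifts that are not in `χ^⊥`. -/
theorem fderiv_endpoints_chi {d : ℕ} (ξ : UnitTangent d) :
    fderiv ℝ (endpoints (d := d)) ξ.1 (chi ξ.1) = 0 := by
  have t1 := (time_sub_pos ξ).ne'
  have t2 := (time_add_pos ξ).ne'
  rw [fderiv_endpoints]
  simp only [Pi.sub_apply, Pi.add_apply] at t1 t2
  refine Prod.ext ?_ ?_ <;> ext i <;> simp [chi] <;> field_simp <;> ring

/-- The projection of a tangent vector of `T¹ℍ^d` to `χ^⊥` along `χ`. -/
theorem sub_smul_chi_mem {d : ℕ} (ξ : UnitTangent d) {X : Minkowski d × Minkowski d}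
    (hX : X ∈ tangentUT ξ) : X - lorentz d ξ.1.2 X.1 • chi ξ.1 ∈ chiPerp ξ := by
  obtain ⟨h1, h2, h3⟩ := hX
  obtain ⟨⟨hx, -⟩, hxv, hv⟩ := ξ.2
  have hvx := hxv
  rw [lorentz_comm] at hvx
  rw [mem_chiPerp]
  refine ⟨?_, ?_, ?_, ?_⟩ <;>
    simp only [chi, Prod.fst_sub, Prod.snd_sub, Prod.smul_fst, Prod.smul_snd, map_sub, map_smul,
      smul_eq_mul, hx, hxv, hv, hvx] <;> linarith

/-- The symplectic form in terms of arbitrary lifts to `T¹ℍ^d`. -/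
theorem Omega_lift {d : ℕ} (ξ : UnitTangent d) {ℓ : GeodesicSpace d} (h : p ξ = ℓ)
    (A B : tangentG ℓ) {X Y : Minkowski d × Minkowski d}
    (hX : X ∈ tangentUT ξ) (hY : Y ∈ tangentUT ξ)
    (hA : A.1 = fderiv ℝ (endpoints (d := d)) ξ.1 X)
    (hB : B.1 = fderiv ℝ (endpoints (d := d)) ξ.1 Y) :
    Omega ℓ A B = lorentz d X.1 Y.2 - lorentz d X.2 Y.1 := by
  have key : ∀ (C : tangentG ℓ) (Z : Minkowski d × Minkowski d) (hZ : Z ∈ tangentUT ξ),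
      C.1 = fderiv ℝ (endpoints (d := d)) ξ.1 Z → C = dpEquiv ξ h ⟨_, sub_smul_chi_mem ξ hZ⟩ := by
    intro C Z hZ hC
    apply Subtype.ext
    change C.1 = fderiv ℝ (endpoints (d := d)) ξ.1 (Z - _)
    rw [map_sub, map_smul, fderiv_endpoints_chi, smul_zero, sub_zero, hC]
  rw [key A X hX hA, key B Y hY hB, Omega_eq, paraSasaki_chiPerp]
  -- Every term produced by the corrections along `χ` contains a factor `⟨x, ẋ⟩`, `⟨v, v̇⟩` or `⟨x,
  -- v⟩`, all of which vanish.
  obtain ⟨h1, h2, h3⟩ := hX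
  obtain ⟨k1, k2, k3⟩ := hY
  obtain ⟨-, hxv, -⟩ := ξ.2
  have hvx := hxv
  rw [lorentz_comm] at hvx
  simp only [J_coe, chi, Prod.fst_sub, Prod.snd_sub, Prod.smul_fst, Prod.smul_snd, map_sub,
    map_smul, LinearMap.sub_apply, LinearMap.smul_apply, smul_eq_mul, hxv, hvx, h1, h2, k1, k2,
    lorentz_comm X.1 ξ.1.1, lorentz_comm X.2 ξ.1.2]
  ring

/-- A Lagrangian subspace, parametrized by `u ↦ (A u, B u)`, is transverse to the vertical
subspace after the geodesic flow at some time. -/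
theorem exists_flow_injective {E : Type*} [AddCommGroup E] [Module ℝ E] [FiniteDimensional ℝ E]
    {d : ℕ} (A B : E →ₗ[ℝ] Minkowski d)
    (hsymm : ∀ u w, lorentz d (A u) (B w) = lorentz d (B u) (A w))
    (hpos : ∀ u, B u ≠ 0 → 0 < lorentz d (B u) (B u)) (hinj : ∀ u, A u = 0 → B u = 0 → u = 0) :
    ∃ t : ℝ, ∀ u, Real.cosh t • A u + Real.sinh t • B u = 0 → u = 0 := by
  by_contra! hcon
  choose u hu hu0 using hcon
  have hA : ∀ t, A (u t) = -(Real.tanh t • B (u t)) := by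
    intro t
    have hc := (Real.cosh_pos t).ne'
    have := congrArg (fun z => (Real.cosh t)⁻¹ • z) (hu t)
    simp only [smul_add, smul_smul, inv_mul_cancel₀ hc, one_smul, smul_zero] at this
    rw [Real.tanh_eq_sinh_div_cosh, div_eq_inv_mul]
    exact eq_neg_of_add_eq_zero_left this
  have hB : ∀ t, B (u t) ≠ 0 := by
    intro t h
    refine hu0 t (hinj _ ?_ h)
    rw [hA, h, smul_zero, neg_zero]
  -- Substituting `A (u t) = -tanh t • B (u t)` into `hsymm` gives `(tanh s - tanh t) ⟨B (u s), B (u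
  -- t)⟩ = 0`, and `tanh` is injective.
  have hortho : ((lorentz d).compl₁₂ B B).IsOrthoᵢ u := by
    intro s t hst
    change lorentz d (B (u s)) (B (u t)) = 0
    have h1 := hsymm (u s) (u t)
    rw [hA, hA] at h1
    simp only [map_neg, map_smul, LinearMap.neg_apply, LinearMap.smul_apply, smul_eq_mul] at h1
    have h2 : (Real.tanh s - Real.tanh t) * lorentz d (B (u s)) (B (u t)) = 0 := by linarith
    refine (mul_eq_zero.1 h2).resolve_left (sub_ne_zero.2 fun h => hst (Real.tanh_injective h))
  -- A linearly independent family indexed by all of `ℝ` cannot exist in the finite-dimensional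
  -- space `E`.
  have hli := LinearMap.linearIndependent_of_isOrthoᵢ hortho fun t h => (hpos _ (hB t)).ne' h
  have := hli.finite
  exact not_finite ℝ

/-! ### Calculus of maps into the unit tangent bundle -/

section Calculus

variable {E : Type*} [NormedAddCommGroup E] [NormedSpace ℝ E] {d : ℕ}

theorem hasFDerivAt_lorentz {f g : E → Minkowski d} {f' g' : E →L[ℝ] Minkowski d} {z : E}
    (hf : HasFDerivAt f f' z) (hg : HasFDerivAt g g' z) :
    ∃ L : E →L[ℝ] ℝ, HasFDerivAt (fun z => lorentz d (f z) (g z)) L z ∧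
      ∀ w, L w = lorentz d (f z) (g' w) + lorentz d (f' w) (g z) :=
  ⟨_, (lorentzL d).hasFDerivAt_of_bilinear hf hg, fun _ => rfl⟩

theorem lorentz_fderiv_add_eq_zero {f g : E → Minkowski d} {f' g' : E →L[ℝ] Minkowski d} {z : E}
    (hf : HasFDerivAt f f' z) (hg : HasFDerivAt g g' z) {c : ℝ}
    (h : ∀ᶠ y in 𝓝 z, lorentz d (f y) (g y) = c) (w : E) :
    lorentz d (f z) (g' w) + lorentz d (f' w) (g z) = 0 := by
  obtain ⟨L, hL, e⟩ := hasFDerivAt_lorentz hf hg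
  rw [← e, (hL.congr_of_eventuallyEq (f₁ := fun _ => c) (h.mono fun y hy => hy.symm)).unique
    (hasFDerivAt_const c z)]
  rfl

theorem fderiv_mem_tangentUT {X V : E → Minkowski d} {X' V' : E →L[ℝ] Minkowski d} {z : E}
    (hX : HasFDerivAt X X' z) (hV : HasFDerivAt V V' z)
    (h : ∀ᶠ y in 𝓝 z, (X y, V y) ∈ UnitTangent d) (ξ : UnitTangent d) (hξ : ξ.1 = (X z, V z))
    (w : E) : (X' w, V' w) ∈ tangentUT ξ := by
  have h1 := lorentz_fderiv_add_eq_zero hX hX (h.mono fun y hy => hy.1.1) w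
  have h2 := lorentz_fderiv_add_eq_zero hV hV (h.mono fun y hy => hy.2.2) w
  have h3 := lorentz_fderiv_add_eq_zero hX hV (h.mono fun y hy => hy.2.1) w
  rw [lorentz_comm (X' w)] at h1 h3
  rw [lorentz_comm (V' w)] at h2
  refine ⟨?_, ?_, ?_⟩ <;> rw [hξ] <;> simp only <;> linarith

/-- The tautological `1`-form `⟨V, dX⟩` and its exterior derivative. -/
theorem hasFDerivAt_tautological {X V : E → Minkowski d} {V' : E →L[ℝ] Minkowski d} {z : E}
    (hX : ContDiffAt ℝ ∞ X z) (hV : HasFDerivAt V V' z) :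
    ∃ L : E →L[ℝ] E →L[ℝ] ℝ,
      HasFDerivAt (fun y => (lorentzL d (V y)).comp (fderiv ℝ X y)) L z ∧
      ∀ u w, L u w - L w u
        = lorentz d (V' u) (fderiv ℝ X z w) - lorentz d (V' w) (fderiv ℝ X z u) := by
  have hX' : DifferentiableAt ℝ (fderiv ℝ X) z :=
    (hX.fderiv_right (m := ∞) (by simp)).differentiableAt (by simp)
  have h1 : HasFDerivAt (fun y => lorentzL d (V y)) ((lorentzL d).comp V') z :=
    (lorentzL d).hasFDerivAt.comp z hV
  refine ⟨_, h1.clm_comp hX'.hasFDerivAt, fun u w => ?_⟩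
  -- The terms `⟨V, D²X⟩` cancel on antisymmetrizing; only the terms with a derivative of `V`
  -- survive.
  have hs : fderiv ℝ (fderiv ℝ X) z u w = fderiv ℝ (fderiv ℝ X) z w u :=
    hX.isSymmSndFDerivAt (by
      rw [minSmoothness_of_isRCLikeNormedField]
      exact (ENat.LEInfty.out : (2 : ℕ∞ω) ≤ ∞)) u w
  simp [hs, lorentzL_apply]

end Calculus

/-! ### Smooth lifts of geodesics and their correction by the flow -/

theorem geodesicFlow_mem {d : ℕ} (t : ℝ) {ξ : Minkowski d × Minkowski d} (h : ξ ∈ UnitTangent d) :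
    geodesicFlow t ξ ∈ UnitTangent d := by
  have t1 : 0 < (ξ.1 - ξ.2) (Fin.last d) := time_sub_pos ⟨ξ, h⟩
  have t2 : 0 < (ξ.1 + ξ.2) (Fin.last d) := time_add_pos ⟨ξ, h⟩
  obtain ⟨⟨hx, -⟩, hxv, hv⟩ := h
  have hvx := hxv
  rw [lorentz_comm] at hvx
  have hcs := Real.cosh_sq t
  refine ⟨⟨?_, ?_⟩, ?_, ?_⟩
  · simp only [geodesicFlow, map_add, map_smul, LinearMap.add_apply, LinearMap.smul_apply,
      smul_eq_mul, hx, hxv, hv, hvx]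
    linear_combination -hcs
  -- The flow scales the future null vectors `x + v` and `x - v` by `exp t` and `exp (-t)`; the new
  -- base point is half their sum.
  · have e1 := congrFun (flow_add t ξ) (Fin.last d)
    have e2 := congrFun (flow_sub t ξ) (Fin.last d)
    simp only [Pi.add_apply, Pi.sub_apply, Pi.smul_apply, smul_eq_mul] at e1 e2 t1 t2
    have := mul_pos (Real.exp_pos t) t2
    have := mul_pos (Real.exp_pos (-t)) t1
    linarith
  · simp only [geodesicFlow, map_add, map_smul, LinearMap.add_apply, LinearMap.smul_apply,
      smul_eq_mul, hx, hxv, hv, hvx]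
    ring
  · simp only [geodesicFlow, map_add, map_smul, LinearMap.add_apply, LinearMap.smul_apply,
      smul_eq_mul, hx, hxv, hv, hvx]
    linear_combination hcs

/-- A unit tangent vector of an oriented geodesic, depending smoothly on the geodesic. -/
def unitLift {d : ℕ} (ℓ : Minkowski d × Minkowski d) : Minkowski d × Minkowski d :=
  ((Real.sqrt (2 / -lorentz d ℓ.1 ℓ.2) / 2) • (ℓ.2 + ℓ.1),
    (Real.sqrt (2 / -lorentz d ℓ.1 ℓ.2) / 2) • (ℓ.2 - ℓ.1))

theorem unitLift_mem {d : ℕ} (ℓ : GeodesicSpace d) : unitLift ℓ.1 ∈ UnitTangent d := by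
  have hm := lorentz_endpoints_neg ℓ
  obtain ⟨⟨b, a⟩, ⟨hb, hb1⟩, ⟨ha, ha1⟩, hne⟩ := ℓ
  simp only at hm hb ha hb1 ha1
  have hab : lorentz d a b = lorentz d b a := lorentz_comm a b
  rw [unitLift]
  simp only
  set m := lorentz d b a
  have hpos : 0 < 2 / (-m) := by apply div_pos <;> linarith
  set s := Real.sqrt (2 / (-m)) with hs
  have hs0 : 0 < s := Real.sqrt_pos.2 hpos
  -- The scale `s` is forced by `x - v = s • b`, `x + v = s • a` and `⟨x - v, x + v⟩ = -2`.
  have hs2 : s * s * m = -2 := by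
    rw [hs, Real.mul_self_sqrt hpos.le]
    have : m ≠ 0 := hm.ne
    field_simp
  refine ⟨⟨?_, ?_⟩, ?_, ?_⟩
  · simp only [map_smul, map_add, LinearMap.smul_apply, LinearMap.add_apply, ha, hb, hab,
      smul_eq_mul]
    linarith
  · simp only [Pi.smul_apply, Pi.add_apply, ha1, hb1, smul_eq_mul]
    linarith
  · simp only [map_smul, map_add, map_sub, LinearMap.smul_apply, LinearMap.add_apply, ha, hb,
      hab, smul_eq_mul]
    ring
  · simp only [map_smul, map_sub, LinearMap.smul_apply, LinearMap.sub_apply, ha, hb, hab,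
      smul_eq_mul]
    linarith

theorem endpoints_unitLift {d : ℕ} (ℓ : GeodesicSpace d) : endpoints (unitLift ℓ.1) = ℓ.1 := by
  have hm := lorentz_endpoints_neg ℓ
  obtain ⟨⟨b, a⟩, ⟨hb, hb1⟩, ⟨ha, ha1⟩, hne⟩ := ℓ
  simp only at hm hb1 ha1
  have hs : Real.sqrt (2 / -lorentz d b a) ≠ 0 := by
    refine (Real.sqrt_pos.2 ?_).ne'
    apply div_pos <;> linarith
  have e1 : (unitLift (b, a)).1 - (unitLift (b, a)).2 = Real.sqrt (2 / -lorentz d b a) • b := by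
    ext i; simp [unitLift]; ring
  have e2 : (unitLift (b, a)).1 + (unitLift (b, a)).2 = Real.sqrt (2 / -lorentz d b a) • a := by
    ext i; simp [unitLift]; ring
  rw [endpoints, e1, e2, ray_smul hs, ray_smul hs, ray, ray, ha1, hb1]
  simp

/-- The only singularities of the formula are at `⟨ℓ₋, ℓ₊⟩ = 0` and at the zero of the square root,
and `⟨ℓ₋, ℓ₊⟩ < 0` on geodesics. Smoothness is in the ambient space, so that it composes with chart
representations. -/
theorem contDiffAt_unitLift {d : ℕ} (ℓ : GeodesicSpace d) :
    ContDiffAt ℝ ∞ (unitLift (d := d)) ℓ.1 := by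
  have hm := lorentz_endpoints_neg ℓ
  have h1 : ContDiffAt ℝ ∞ (fun ℓ : Minkowski d × Minkowski d => lorentz d ℓ.1 ℓ.2) ℓ.1 :=
    (lorentz d).toContinuousBilinearMap.isBoundedBilinearMap.contDiff.contDiffAt
  have h2 : ContDiffAt ℝ ∞ (fun ℓ : Minkowski d × Minkowski d =>
      Real.sqrt (2 / -lorentz d ℓ.1 ℓ.2) / 2) ℓ.1 := by
    refine ContDiffAt.div_const (ContDiffAt.sqrt (contDiffAt_const.div h1.neg ?_) ?_) _
    · linarith
    · refine (div_pos two_pos ?_).ne'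
      linarith
  exact (h2.smul (contDiffAt_snd.add contDiffAt_fst)).prodMk
    (h2.smul (contDiffAt_snd.sub contDiffAt_fst))

section Calculus

variable {E : Type*} [NormedAddCommGroup E] [NormedSpace ℝ E] {d : ℕ}

/-- If the tautological form `⟨V, dX⟩` of a field `(X, V)` of unit tangent vectors is closed, then
`(X, V)` can be moved by the geodesic flow to `(X₁, V₁)` with `⟨V₁, dX₁⟩ = 0`, and the
free constant can be chosen such that `X₁` is an immersion at a given point. -/
theorem exists_normal_lift [FiniteDimensional ℝ E] {s : Set E} (hs : IsOpen s) (hc : Convex ℝ s)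
    {X V : E → Minkowski d} (hX : ContDiffOn ℝ ∞ X s) (hV : ContDiffOn ℝ ∞ V s)
    (hU : ∀ y ∈ s, (X y, V y) ∈ UnitTangent d)
    (hsymm : ∀ y ∈ s, ∀ u w, lorentz d (fderiv ℝ X y u) (fderiv ℝ V y w)
      = lorentz d (fderiv ℝ V y u) (fderiv ℝ X y w))
    {z : E} (hz : z ∈ s)
    (hinj : ∀ w, fderiv ℝ (endpoints (d := d)) (X z, V z) (fderiv ℝ X z w, fderiv ℝ V z w) = 0 →
      w = 0) :
    ∃ X₁ V₁ : E → Minkowski d, ContDiffOn ℝ ∞ X₁ s ∧ ContDiffOn ℝ ∞ V₁ s ∧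
      (∀ y ∈ s, (X₁ y, V₁ y) ∈ UnitTangent d ∧ endpoints (X₁ y, V₁ y) = endpoints (X y, V y) ∧
        ∀ w, lorentz d (V₁ y) (fderiv ℝ X₁ y w) = 0) ∧
      Function.Injective (fderiv ℝ X₁ z) := by
  have hXa : ∀ y ∈ s, ContDiffAt ℝ ∞ X y := fun y hy => hX.contDiffAt (hs.mem_nhds hy)
  have hVa : ∀ y ∈ s, ContDiffAt ℝ ∞ V y := fun y hy => hV.contDiffAt (hs.mem_nhds hy)
  have hXd : ∀ y ∈ s, HasFDerivAt X (fderiv ℝ X y) y := fun y hy =>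
    ((hXa y hy).differentiableAt (by simp)).hasFDerivAt
  have hVd : ∀ y ∈ s, HasFDerivAt V (fderiv ℝ V y) y := fun y hy =>
    ((hVa y hy).differentiableAt (by simp)).hasFDerivAt
  have htan : ∀ (y : E) (hy : y ∈ s) (w : E),
      (fderiv ℝ X y w, fderiv ℝ V y w) ∈ tangentUT (⟨_, hU y hy⟩ : UnitTangent d) := fun y hy w =>
    fderiv_mem_tangentUT (hXd y hy) (hVd y hy)
      (Filter.eventually_of_mem (hs.mem_nhds hy) hU) _ rfl w
  set θ : E → E →L[ℝ] ℝ := fun y => (lorentzL d (V y)).comp (fderiv ℝ X y) with hθ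
  have hθs : ContDiffOn ℝ ∞ θ s := by
    have h1 : ContDiffOn ℝ ∞ (fderiv ℝ X) s := hX.fderiv_of_isOpen hs (by simp)
    exact ((lorentzL d).contDiff.comp_contDiffOn hV).clm_comp h1
  have hclosed : ∀ y ∈ s, ∀ u w, fderiv ℝ θ y u w = fderiv ℝ θ y w u := by
    intro y hy u w
    obtain ⟨L, hL, e⟩ := hasFDerivAt_tautological (hXa y hy) (hVd y hy)
    rw [hL.fderiv]
    have h1 := e u w
    rw [lorentz_comm (fderiv ℝ V y w), hsymm y hy, sub_self] at h1
    linarith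
  -- Poincaré lemma on the convex set `s`; the symmetry of `fderiv ℝ θ` is closedness of `θ`.
  obtain ⟨f, hf⟩ := hc.exists_forall_hasFDerivAt_of_fderiv_symmetric hs
    (hθs.differentiableOn (by simp)) hclosed
  have hfs : ContDiffOn ℝ ∞ f s := by
    rw [contDiffOn_infty_iff_fderiv_of_isOpen hs]
    exact ⟨fun y hy => (hf y hy).differentiableAt.differentiableWithinAt,
      hθs.congr fun y hy => (hf y hy).fderiv⟩
  -- `(A u, B u)` is the projection of `(dX u, dV u)` to `χ^⊥` along `χ = (V, X)`, at the point `z`.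
  let A : E →ₗ[ℝ] Minkowski d :=
    (fderiv ℝ X z).toLinearMap - (θ z).toLinearMap.smulRight (V z)
  let B : E →ₗ[ℝ] Minkowski d :=
    (fderiv ℝ V z).toLinearMap - (θ z).toLinearMap.smulRight (X z)
  have hA : ∀ u, A u = fderiv ℝ X z u - lorentz d (V z) (fderiv ℝ X z u) • V z := fun u => rfl
  have hB : ∀ u, B u = fderiv ℝ V z u - lorentz d (V z) (fderiv ℝ X z u) • X z := fun u => rfl
  obtain ⟨⟨hxx, -⟩, hxv, hvv⟩ := hU z hz
  simp only at hxx hxv hvv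
  have hvx := hxv
  rw [lorentz_comm] at hvx
  obtain ⟨t, ht⟩ : ∃ t : ℝ, ∀ u, Real.cosh t • A u + Real.sinh t • B u = 0 → u = 0 := by
    refine exists_flow_injective A B (fun u w => ?_) (fun u hu => ?_) (fun u hu1 hu2 => ?_)
    · obtain ⟨h1, h2, h3⟩ := htan z hz u
      obtain ⟨k1, k2, k3⟩ := htan z hz w
      have := hsymm z hz u w
      simp only at h1 h2 h3 k1 k2 k3
      simp only [hA, hB, map_sub, map_smul, LinearMap.sub_apply, LinearMap.smul_apply, smul_eq_mul,
        lorentz_comm (fderiv ℝ X z u) (X z), lorentz_comm (fderiv ℝ V z u) (V z), hvx, hxv, h1, h2,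
        k1, k2]
      linarith
    · refine lorentz_self_pos (hU z hz).1 ?_ hu
      obtain ⟨-, -, h3⟩ := htan z hz u
      simp only at h3
      simp only [hB, map_sub, map_smul, smul_eq_mul, hxx]
      linarith
    -- If the projection vanishes, then `(dX u, dV u)` is a multiple of `χ`, which the differential
    -- of `endpoints` kills.
    · refine hinj u ?_
      rw [hA, sub_eq_zero] at hu1
      rw [hB, sub_eq_zero] at hu2
      have e : (fderiv ℝ X z u, fderiv ℝ V z u)
          = lorentz d (V z) (fderiv ℝ X z u) • chi (X z, V z) := Prod.ext hu1 hu2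
      rw [e, map_smul, fderiv_endpoints_chi ⟨_, hU z hz⟩, smul_zero]
  -- The primitive enters with a minus sign to cancel `θ`; the constant is fixed by `F z = t`, the
  -- good time at `z`.
  set F : E → ℝ := fun y => -f y + (f z + t) with hF
  have hFs : ContDiffOn ℝ ∞ F s := hfs.neg.add contDiffOn_const
  have hFd : ∀ y ∈ s, HasFDerivAt F (-θ y) y := fun y hy => (hf y hy).neg.add_const _
  have hFz : F z = t := by simp [hF]
  have hX₁ : ∀ y ∈ s, ∀ w, fderiv ℝ (fun y => (geodesicFlow (F y) (X y, V y)).1) y w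
      = (Real.cosh (F y) • fderiv ℝ X y w + Real.sinh (F y) • fderiv ℝ V y w)
        - lorentz d (V y) (fderiv ℝ X y w) • (Real.sinh (F y) • X y + Real.cosh (F y) • V y) := by
    intro y hy w
    have h1 := (hFd y hy).cosh.smul (hXd y hy)
    have h2 := (hFd y hy).sinh.smul (hVd y hy)
    have h3 : HasFDerivAt (fun y => (geodesicFlow (F y) (X y, V y)).1) _ y := h1.add h2
    rw [h3.fderiv]
    ext i
    simp [hθ, lorentzL_apply]
    ring
  refine ⟨fun y => (geodesicFlow (F y) (X y, V y)).1, fun y => (geodesicFlow (F y) (X y, V y)).2,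
    (hFs.cosh.smul hX).add (hFs.sinh.smul hV), (hFs.sinh.smul hX).add (hFs.cosh.smul hV),
    fun y hy => ⟨geodesicFlow_mem _ (hU y hy), endpoints_flow _ _, fun w => ?_⟩, ?_⟩
  · rw [hX₁ y hy]
    obtain ⟨h1, h2, h3⟩ := htan y hy w
    obtain ⟨⟨hxx, -⟩, hxv, hvv⟩ := hU y hy
    simp only at hxx hxv hvv h1 h2 h3
    have hvx := hxv
    rw [lorentz_comm] at hvx
    have hcs := Real.cosh_sq (F y)
    -- With this, both parts of `dX₁ w` pair with `V₁` to `(cosh² - sinh²) θ(w)`, with opposite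
    -- signs.
    have h3' : lorentz d (X y) (fderiv ℝ V y w) = - lorentz d (V y) (fderiv ℝ X y w) := by linarith
    simp only [geodesicFlow, map_add, map_sub, map_smul, LinearMap.add_apply,
      LinearMap.smul_apply, smul_eq_mul, hxx, hxv, hvx, hvv, h1, h2, h3']
    ring
  · refine (injective_iff_map_eq_zero _).2 fun u hu => ht u ?_
    rw [hX₁ z hz, hFz] at hu
    -- At `z` the differential of `X₁` is exactly `cosh t • A + sinh t • B`.
    rw [← hu, hA, hB]
    module

end Calculus

/-! ### Differentials in charts -/

section Charts

variable {n : ℕ} {N : Type*} [TopologicalSpace N] [ChartedSpace (EuclideanSpace ℝ (Fin n)) N]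
  {V : Type*} [NormedAddCommGroup V] [NormedSpace ℝ V]

theorem bijective_mfderiv_extChartAt [IsManifold (𝓡 n) ∞ N] {q₀ q : N}
    (hq : q ∈ (extChartAt (𝓡 n) q₀).source) :
    Function.Bijective (mfderiv (𝓡 n) 𝓘(ℝ, EuclideanSpace ℝ (Fin n)) (extChartAt (𝓡 n) q₀) q) := by
  have : IsManifold (𝓡 n) 1 N := IsManifold.of_le (n := ∞) (by simp)
  exact (isInvertible_mfderiv_extChartAt (I := 𝓡 n) hq).bijective

theorem mfderiv_comp_extChartAt [IsManifold (𝓡 n) ∞ N] {q₀ q : N}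
    (hq : q ∈ (extChartAt (𝓡 n) q₀).source)
    {f : N → V} {F : EuclideanSpace ℝ (Fin n) → V}
    (hF : DifferentiableAt ℝ F (extChartAt (𝓡 n) q₀ q))
    (hf : ∀ᶠ r in 𝓝 q, f r = F (extChartAt (𝓡 n) q₀ r)) (u : TangentSpace (𝓡 n) q) :
    mfderiv (𝓡 n) 𝓘(ℝ, V) f q u = fderiv ℝ F (extChartAt (𝓡 n) q₀ q)
      (mfderiv (𝓡 n) 𝓘(ℝ, EuclideanSpace ℝ (Fin n)) (extChartAt (𝓡 n) q₀) q u) := by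
  have : IsManifold (𝓡 n) 1 N := IsManifold.of_le (n := ∞) (by simp)
  have h1 : MDifferentiableAt (𝓡 n) 𝓘(ℝ, EuclideanSpace ℝ (Fin n)) (extChartAt (𝓡 n) q₀) q :=
    mdifferentiableAt_extChartAt (by simpa using hq)
  have h2 := HasMFDerivAt.comp q hF.hasFDerivAt.hasMFDerivAt h1.hasMFDerivAt
  rw [(h2.congr_of_eventuallyEq hf).mfderiv]
  rfl

theorem contDiffAt_comp_extChartAt_symm [IsManifold (𝓡 n) ∞ N] {q₀ q : N}
    (hq : q ∈ (extChartAt (𝓡 n) q₀).source) {f : N → V}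
    (hf : ContMDiffAt (𝓡 n) 𝓘(ℝ, V) ∞ f q) :
    ContDiffAt ℝ ∞ (f ∘ (extChartAt (𝓡 n) q₀).symm) (extChartAt (𝓡 n) q₀ q) := by
  have h1 := (contMDiffAt_iff_source_of_mem_source (I := 𝓡 n) (x := q₀) (by simpa using hq)).1 hf
  simp only [modelWithCornersSelf_coe, Set.range_id, contMDiffWithinAt_univ] at h1
  exact h1.contDiffAt

omit [NormedAddCommGroup V] [NormedSpace ℝ V] in
theorem eventually_eq_comp_extChartAt {q₀ q : N}
    (hq : q ∈ (extChartAt (𝓡 n) q₀).source) (f : N → V) :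
    ∀ᶠ r in 𝓝 q, f r = (f ∘ (extChartAt (𝓡 n) q₀).symm) (extChartAt (𝓡 n) q₀ r) := by
  filter_upwards [(isOpen_extChartAt_source (I := 𝓡 n) q₀).mem_nhds hq] with r hr
  rw [Function.comp_apply, (extChartAt (𝓡 n) q₀).left_inv hr]

theorem mfderiv_eq_fderiv_extChartAt [IsManifold (𝓡 n) ∞ N] {q₀ q : N}
    (hq : q ∈ (extChartAt (𝓡 n) q₀).source) {f : N → V}
    (hf : ContMDiffAt (𝓡 n) 𝓘(ℝ, V) ∞ f q) (u : TangentSpace (𝓡 n) q) :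
    mfderiv (𝓡 n) 𝓘(ℝ, V) f q u
      = fderiv ℝ (f ∘ (extChartAt (𝓡 n) q₀).symm) (extChartAt (𝓡 n) q₀ q)
        (mfderiv (𝓡 n) 𝓘(ℝ, EuclideanSpace ℝ (Fin n)) (extChartAt (𝓡 n) q₀) q u) :=
  mfderiv_comp_extChartAt hq
    ((contDiffAt_comp_extChartAt_symm hq hf).differentiableAt (by simp))
    (eventually_eq_comp_extChartAt hq f) u

/-- The chart of `U` at `r` is the chart of `N` at `r.1` composed with the inclusion, and both
charts have bijective differentials. -/
theorem bijective_mfderiv_subtype_val [IsManifold (𝓡 n) ∞ N] (U : TopologicalSpace.Opens N)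
    (r : U) : Function.Bijective (mfderiv (𝓡 n) (𝓡 n) (Subtype.val : U → N) r) := by
  have h1 := bijective_mfderiv_extChartAt (n := n) (mem_extChartAt_source (I := 𝓡 n) r)
  have h2 := bijective_mfderiv_extChartAt (n := n) (mem_extChartAt_source (I := 𝓡 n) r.1)
  have h3 : (extChartAt (𝓡 n) r : U → _) = extChartAt (𝓡 n) r.1 ∘ Subtype.val := rfl
  have : IsManifold (𝓡 n) 1 N := IsManifold.of_le (n := ∞) (by simp)
  have h4 : MDifferentiableAt (𝓡 n) 𝓘(ℝ, EuclideanSpace ℝ (Fin n)) (extChartAt (𝓡 n) r.1) r.1 :=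
    mdifferentiableAt_extChartAt (by simp)
  have h5 : MDifferentiableAt (𝓡 n) (𝓡 n) (Subtype.val : U → N) r :=
    (contMDiff_subtype_val (n := ∞) r).mdifferentiableAt (by simp)
  have h6 := mfderiv_comp r h4 h5
  rw [h3, h6] at h1
  exact (Function.Bijective.of_comp_iff' h2 _).1 h1

theorem mfderiv_comp_subtype_val [IsManifold (𝓡 n) ∞ N] (U : TopologicalSpace.Opens N)
    {f : N → V} (r : U) (hf : ContMDiffAt (𝓡 n) 𝓘(ℝ, V) ∞ f r.1) (u : TangentSpace (𝓡 n) r) :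
    mfderiv (𝓡 n) 𝓘(ℝ, V) (fun r : U => f r) r u
      = mfderiv (𝓡 n) 𝓘(ℝ, V) f r.1 (mfderiv (𝓡 n) (𝓡 n) (Subtype.val : U → N) r u) := by
  have h4 : MDifferentiableAt (𝓡 n) 𝓘(ℝ, V) f r.1 := hf.mdifferentiableAt (by simp)
  have h5 : MDifferentiableAt (𝓡 n) (𝓡 n) (Subtype.val : U → N) r :=
    (contMDiff_subtype_val (n := ∞) r).mdifferentiableAt (by simp)
  exact congrArg (fun T => T u) (mfderiv_comp r h4 h5)

end Charts

/-! ### The orientation induced by a unit normal field -/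

section Orientation

variable {n : ℕ} {N : Type*} [TopologicalSpace N] [ChartedSpace (EuclideanSpace ℝ (Fin n)) N]

/-- The `n`-form `(u₁, …, u_n) ↦ det (x, v, L u₁, …, L u_n)`. -/
def detForm (x v : Minkowski (n + 1))
    (L : EuclideanSpace ℝ (Fin n) →L[ℝ] Minkowski (n + 1)) :
    EuclideanSpace ℝ (Fin n) [⋀^Fin n]→ₗ[ℝ] ℝ :=
  (((Matrix.detRowAlternating (R := ℝ) (n := Fin (n + 2))).curryLeft x).curryLeft v).compLinearMap
    L.toLinearMap

theorem detForm_apply (x v : Minkowski (n + 1))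
    (L : EuclideanSpace ℝ (Fin n) →L[ℝ] Minkowski (n + 1)) (e : Fin n → EuclideanSpace ℝ (Fin n)) :
    detForm x v L e = Matrix.det (Matrix.of (Fin.cons x (Fin.cons v fun i => L (e i)))) := rfl

/-- Pairing a linear relation with `x` and with `v` isolates their coefficients, because `⟨x, x⟩ =
-1`, `⟨v, v⟩ = 1` and all other pairings vanish. -/
theorem linearIndependent_cons_cons {d n : ℕ} {x v : Minkowski d} (h : (x, v) ∈ UnitTangent d)
    {w : Fin n → Minkowski d} (hw : LinearIndependent ℝ w)
    (hx : ∀ i, lorentz d x (w i) = 0) (hv : ∀ i, lorentz d v (w i) = 0) :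
    LinearIndependent ℝ (Fin.cons x (Fin.cons v w) : Fin (n + 2) → Minkowski d) := by
  obtain ⟨⟨hxx, -⟩, hxv, hvv⟩ := h
  simp only at hxx hxv hvv
  rw [Fintype.linearIndependent_iff] at hw ⊢
  intro c hc
  rw [Fin.sum_univ_succ, Fin.sum_univ_succ] at hc
  simp only [Fin.cons_zero, Fin.cons_succ] at hc
  have hvx := hxv
  rw [lorentz_comm] at hvx
  have h0 : c 0 = 0 := by
    have := congrArg (lorentz d x) hc
    simp [hxx, hxv, hx] at this
    exact this
  have h1 : c 1 = 0 := by
    have := congrArg (lorentz d v) hc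
    simp [hvv, hvx, hv] at this
    exact this
  have h1' : c (Fin.succ 0) = 0 := h1
  rw [h0, h1', zero_smul, zero_smul, zero_add, zero_add] at hc
  have h2 := hw _ hc
  intro i
  refine Fin.cases h0 (fun i => Fin.cases h1 h2 i) i

/-- Evaluated on a basis, the form is the determinant of `n + 2` independent vectors of `ℝ^{n+2}`:
the point, the normal and a basis of the image of `dσ`. -/
theorem normalForm_ne_zero {σ : N → Hyp (n + 1)} {q : N} {v : Minkowski (n + 1)}
    (hinj : Function.Injective (mfderiv (𝓡 n) 𝓘(ℝ, Minkowski (n + 1))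
      (fun q => (σ q : Minkowski (n + 1))) q))
    (hv : ((σ q : Minkowski (n + 1)), v) ∈ UnitTangent (n + 1))
    (hx : ∀ u : TangentSpace (𝓡 n) q, lorentz (n + 1) (σ q) (mfderiv (𝓡 n) 𝓘(ℝ, Minkowski (n + 1))
      (fun q => (σ q : Minkowski (n + 1))) q u) = 0)
    (hn : ∀ u : TangentSpace (𝓡 n) q, lorentz (n + 1) v (mfderiv (𝓡 n) 𝓘(ℝ, Minkowski (n + 1))
      (fun q => (σ q : Minkowski (n + 1))) q u) = 0) :
    normalForm σ q v ≠ 0 := by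
  let e : Module.Basis (Fin n) ℝ (EuclideanSpace ℝ (Fin n)) :=
    (EuclideanSpace.basisFun (Fin n) ℝ).toBasis
  let L : EuclideanSpace ℝ (Fin n) →L[ℝ] Minkowski (n + 1) :=
    mfderiv (𝓡 n) 𝓘(ℝ, Minkowski (n + 1)) (fun q => (σ q : Minkowski (n + 1))) q
  have hL : LinearIndependent ℝ fun i => L (e i) :=
    e.linearIndependent.map' L.toLinearMap (LinearMap.ker_eq_bot.2 hinj)
  have hli := linearIndependent_cons_cons hv hL (fun i => hx (e i)) (fun i => hn (e i))
  intro h0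
  have h1 : detForm (σ q : Minkowski (n + 1)) v L e = 0 := congrArg (fun α => α e) h0
  rw [detForm_apply] at h1
  have h2 := (Matrix.linearIndependent_rows_iff_isUnit (A := Matrix.of
    (Fin.cons (σ q : Minkowski (n + 1)) (Fin.cons v fun i => L (e i))))).1 hli
  rw [Matrix.isUnit_iff_isUnit_det, h1] at h2
  exact not_isUnit_zero h2

/-- A nowhere vanishing `normalForm` orients the manifold. -/
theorem exists_orientation [IsManifold (𝓡 n) ∞ N] {σ : N → Hyp (n + 1)}
    (hσ : ContMDiff (𝓡 n) 𝓘(ℝ, Minkowski (n + 1)) ∞ fun q => (σ q : Minkowski (n + 1)))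
    {ν : N → Minkowski (n + 1)} (hν : Continuous ν) (h0 : ∀ q, normalForm σ q (ν q) ≠ 0) :
    ∃ o : ManifoldOrientation n N, ∀ q, o.orient q = rayOfNeZero ℝ _ (h0 q) := by
  refine ⟨⟨fun q => rayOfNeZero ℝ _ (h0 q), fun q₀ => ?_⟩, fun q => rfl⟩
  let e : Module.Basis (Fin n) ℝ (EuclideanSpace ℝ (Fin n)) :=
    (EuclideanSpace.basisFun (Fin n) ℝ).toBasis
  set φ := extChartAt (𝓡 n) q₀ with hφ
  let f : EuclideanSpace ℝ (Fin n) → Minkowski (n + 1) :=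
    (fun q => (σ q : Minkowski (n + 1))) ∘ φ.symm
  let β : N → EuclideanSpace ℝ (Fin n) [⋀^Fin n]→ₗ[ℝ] ℝ :=
    fun q => detForm (σ q) (ν q) (fderiv ℝ f (φ q))
  have hn : ∀ q ∈ φ.source, normalForm σ q (ν q) = (β q).compLinearMap
      (mfderiv (𝓡 n) 𝓘(ℝ, EuclideanSpace ℝ (Fin n)) φ q).toLinearMap := by
    intro q hq
    have h1 : (mfderiv (𝓡 n) 𝓘(ℝ, Minkowski (n + 1)) (fun q => (σ q : Minkowski (n + 1)))
        q).toLinearMap = (fderiv ℝ f (φ q)).toLinearMap ∘ₗ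
          (mfderiv (𝓡 n) 𝓘(ℝ, EuclideanSpace ℝ (Fin n)) φ q).toLinearMap :=
      LinearMap.ext fun u => mfderiv_eq_fderiv_extChartAt hq (hσ q) u
    rw [normalForm, h1]
    rfl
  have hcont : ContinuousAt (fun q => β q e) q₀ := by
    have hq := mem_extChartAt_source (I := 𝓡 n) q₀
    have h1 : ContinuousAt (fun q => fderiv ℝ f (φ q)) q₀ :=
      ContinuousAt.comp (g := fderiv ℝ f)
        ((contDiffAt_comp_extChartAt_symm hq (hσ q₀)).fderiv_right (m := ∞) (by simp)).continuousAt
        (continuousAt_extChartAt q₀)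
    simp only [β, detForm_apply]
    refine ContinuousAt.comp (g := Matrix.det)
      (Continuous.matrix_det continuous_id).continuousAt ?_
    refine continuousAt_pi.2 fun i => ?_
    refine Fin.cases (hσ q₀).continuousAt (fun i => Fin.cases hν.continuousAt (fun i => ?_) i) i
    exact h1.clm_apply continuousAt_const
  -- Top-degree forms are a line, so the ray of `β q` is governed by the sign of the continuous
  -- function `β q e`, which is constant near `q₀`.
  have hβ : ∀ q, β q = β q e • e.det := fun q => (β q).eq_smul_basis_det e
  have hc0 : β q₀ e ≠ 0 := by
    intro h
    apply h0 q₀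
    rw [hn q₀ (mem_extChartAt_source q₀), hβ, h, zero_smul]
    rfl
  refine ⟨β q₀, ?_⟩
  have hpos : ∀ᶠ q in 𝓝 q₀, 0 < β q₀ e * β q e :=
    (continuousAt_const.mul hcont).eventually (lt_mem_nhds (mul_self_pos.2 hc0))
  filter_upwards [hpos,
    (isOpen_extChartAt_source (I := 𝓡 n) q₀).mem_nhds (mem_extChartAt_source q₀)]
    with q hq hqs
  have hr : 0 < β q e / β q₀ e := by
    rw [div_eq_mul_inv]
    have := mul_pos hq (mul_self_pos.2 (inv_ne_zero hc0))
    field_simp at this ⊢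
    exact this
  have hsm : normalForm σ q (ν q) = (β q e / β q₀ e) • (β q₀).compLinearMap
      (mfderiv (𝓡 n) 𝓘(ℝ, EuclideanSpace ℝ (Fin n)) φ q).toLinearMap := by
    have h1 : β q = (β q e / β q₀ e) • β q₀ := by
      rw [hβ q₀, smul_smul, AlternatingMap.smul_apply, e.det_self, smul_eq_mul, mul_one,
        div_mul_cancel₀ _ hc0]
      exact hβ q
    rw [hn q hqs]
    exact congrArg (fun α => α.compLinearMap
      (mfderiv (𝓡 n) 𝓘(ℝ, EuclideanSpace ℝ (Fin n)) φ q).toLinearMap) h1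
  have hne : (β q₀).compLinearMap
      (mfderiv (𝓡 n) 𝓘(ℝ, EuclideanSpace ℝ (Fin n)) φ q).toLinearMap ≠ 0 := by
    intro h
    apply h0 q
    rw [hsm, h, smul_zero]
  refine ⟨hne, (ray_eq_iff _ _).2 ?_⟩
  rw [hsm]
  exact SameRay.sameRay_pos_smul_left _ hr

end Orientation

/-! ### The two implications of the theorem -/

theorem hasFDerivAt_endpoints_comp {E : Type*} [NormedAddCommGroup E] [NormedSpace ℝ E] {d : ℕ}
    {X V : E → Minkowski d} {X' V' : E →L[ℝ] Minkowski d} {z : E}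
    (hX : HasFDerivAt X X' z) (hV : HasFDerivAt V V' z) (h : (X z, V z) ∈ UnitTangent d) :
    HasFDerivAt (fun y => endpoints (X y, V y))
      ((fderiv ℝ (endpoints (d := d)) (X z, V z)).comp (X'.prod V')) z := by
  obtain ⟨L, hL, -⟩ := hasFDerivAt_endpoints ⟨_, h⟩
  have hL' : HasFDerivAt (endpoints (d := d)) L (X z, V z) := hL
  rw [hL'.fderiv]
  exact hL'.comp z (hX.prodMk hV)

section Lagrangian

variable {n d : ℕ} {N : Type*} [TopologicalSpace N] [ChartedSpace (EuclideanSpace ℝ (Fin n)) N]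

/-- The pull-back of the symplectic form in terms of a lift to `T¹ℍ^d` of a chart representation. -/
theorem Omega_dG [IsManifold (𝓡 n) ∞ N] (G : N → GeodesicSpace d) {q₀ q : N}
    (hq : q ∈ (extChartAt (𝓡 n) q₀).source) {X V : EuclideanSpace ℝ (Fin n) → Minkowski d}
    (hX : DifferentiableAt ℝ X (extChartAt (𝓡 n) q₀ q))
    (hV : DifferentiableAt ℝ V (extChartAt (𝓡 n) q₀ q))
    (hU : ∀ᶠ y in 𝓝 (extChartAt (𝓡 n) q₀ q), (X y, V y) ∈ UnitTangent d)
    (hG : ∀ᶠ r in 𝓝 q,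
      (G r).1 = endpoints (X (extChartAt (𝓡 n) q₀ r), V (extChartAt (𝓡 n) q₀ r)))
    (u w : TangentSpace (𝓡 n) q) :
    let u' := mfderiv (𝓡 n) 𝓘(ℝ, EuclideanSpace ℝ (Fin n)) (extChartAt (𝓡 n) q₀) q u
    let w' := mfderiv (𝓡 n) 𝓘(ℝ, EuclideanSpace ℝ (Fin n)) (extChartAt (𝓡 n) q₀) q w
    Omega (G q) (dG G q u) (dG G q w)
      = lorentz d (fderiv ℝ X (extChartAt (𝓡 n) q₀ q) u') (fderiv ℝ V (extChartAt (𝓡 n) q₀ q) w')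
        - lorentz d (fderiv ℝ V (extChartAt (𝓡 n) q₀ q) u')
          (fderiv ℝ X (extChartAt (𝓡 n) q₀ q) w') := by
  intro u' w'
  let ξ : UnitTangent d := ⟨_, hU.self_of_nhds⟩
  have hξ : p ξ = G q := Subtype.ext hG.self_of_nhds.symm
  have hc := hasFDerivAt_endpoints_comp hX.hasFDerivAt hV.hasFDerivAt hU.self_of_nhds
  have key : ∀ t : TangentSpace (𝓡 n) q, (dG G q t).1 = fderiv ℝ (endpoints (d := d)) ξ.1
      (fderiv ℝ X (extChartAt (𝓡 n) q₀ q)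
        (mfderiv (𝓡 n) 𝓘(ℝ, EuclideanSpace ℝ (Fin n)) (extChartAt (𝓡 n) q₀) q t),
      fderiv ℝ V (extChartAt (𝓡 n) q₀ q)
        (mfderiv (𝓡 n) 𝓘(ℝ, EuclideanSpace ℝ (Fin n)) (extChartAt (𝓡 n) q₀) q t)) := by
    intro t
    refine (mfderiv_comp_extChartAt hq hc.differentiableAt hG t).trans ?_
    rw [hc.fderiv]
    rfl
  exact Omega_lift ξ hξ _ _
    (fderiv_mem_tangentUT hX.hasFDerivAt hV.hasFDerivAt hU ξ rfl u')
    (fderiv_mem_tangentUT hX.hasFDerivAt hV.hasFDerivAt hU ξ rfl w') (key u) (key w)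

/-- The unit normal field is determined by the immersion and its Gauss map. -/
theorem normal_eq_of_p {d : ℕ} (ξ : UnitTangent d) :
    lorentz d ξ.1.1 (p ξ).1.2 ≠ 0 ∧
      ξ.1.2 = -(lorentz d ξ.1.1 (p ξ).1.2)⁻¹ • (p ξ).1.2 - ξ.1.1 := by
  have t2 := (time_add_pos ξ).ne'
  obtain ⟨⟨hx, -⟩, hxv, -⟩ := ξ.2
  -- The forward endpoint is `x + v` divided by its last coordinate, and `⟨x, x + v⟩ = -1` recovers
  -- that coordinate.
  have e : lorentz d ξ.1.1 (p ξ).1.2 = -((ξ.1.1 + ξ.1.2) (Fin.last d))⁻¹ := by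
    change lorentz d ξ.1.1 (ray _) = _
    rw [ray, map_smul, map_add, hx, hxv]
    simp
  rw [e]
  refine ⟨neg_ne_zero.2 (inv_ne_zero t2), ?_⟩
  change _ = _ • ray _ - _
  rw [ray, smul_smul, inv_neg, neg_neg, inv_inv, mul_inv_cancel₀ t2, one_smul, add_sub_cancel_left]

/-- Gauss maps are Lagrangian. -/
theorem isLagrangian_of_isGaussMap [IsManifold (𝓡 n) ∞ N] {G : N → GeodesicSpace (n + 1)}
    (hG : ContMDiff (𝓡 n) 𝓘(ℝ, Minkowski (n + 1) × Minkowski (n + 1)) ∞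
      (fun q => (G q : Minkowski (n + 1) × Minkowski (n + 1))))
    {o : ManifoldOrientation n N} {σ : N → Hyp (n + 1)} (hσ : IsImmersionHyp (n := n) σ)
    (h : IsGaussMap o σ G) : IsLagrangian G := by
  obtain ⟨ν, hν, hGν⟩ := h
  intro q u w
  set φ := extChartAt (𝓡 n) q with hφ
  set z := φ q with hz
  have hq : q ∈ φ.source := mem_extChartAt_source q
  let X : EuclideanSpace ℝ (Fin n) → Minkowski (n + 1) :=
    (fun q => (σ q : Minkowski (n + 1))) ∘ φ.symm
  let V : EuclideanSpace ℝ (Fin n) → Minkowski (n + 1) := ν ∘ φ.symm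
  have hX : ContDiffAt ℝ ∞ X z := contDiffAt_comp_extChartAt_symm hq (hσ.1 q)
  have ha : ContDiffAt ℝ ∞ (fun y => (G (φ.symm y)).1.2) z :=
    ContDiffAt.snd (contDiffAt_comp_extChartAt_symm hq (hG q))
  -- `IsCompatibleNormal` contains no regularity of `ν`; expressing `ν` through `σ` and `G` makes it
  -- smooth.
  have hnu : ∀ r, lorentz (n + 1) (σ r) (G r).1.2 ≠ 0 ∧
      ν r = -(lorentz (n + 1) (σ r) (G r).1.2)⁻¹ • (G r).1.2 - (σ r : Minkowski (n + 1)) := by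
    intro r
    have := normal_eq_of_p ⟨((σ r : Minkowski (n + 1)), ν r), (hν r).1⟩
    rwa [← hGν r] at this
  have hV : ContDiffAt ℝ ∞ V z := by
    have e : V = fun y => -(lorentz (n + 1) (X y) (G (φ.symm y)).1.2)⁻¹ • (G (φ.symm y)).1.2
        - X y := funext fun y => (hnu (φ.symm y)).2
    rw [e]
    have h1 : ContDiffAt ℝ ∞ (fun y => lorentz (n + 1) (X y) (G (φ.symm y)).1.2) z :=
      ((lorentzL (n + 1)).contDiff.contDiffAt.comp z hX).clm_apply ha
    exact ((h1.inv (hnu _).1).neg.smul ha).sub hX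
  have hnormal : ∀ y ∈ φ.target, ∀ t, lorentz (n + 1) (V y) (fderiv ℝ X y t) = 0 := by
    intro y hy t
    have hr : φ.symm y ∈ φ.source := φ.map_target hy
    obtain ⟨t', rfl⟩ := (bijective_mfderiv_extChartAt hr).2 t
    have h1 := mfderiv_eq_fderiv_extChartAt hr (hσ.1 (φ.symm y)) t'
    have h2 := (hν (φ.symm y)).2.1 t'
    rw [h1] at h2
    have h3 : φ (φ.symm y) = y := φ.right_inv hy
    rw [← hφ, h3] at h2
    exact h2
  have hVd := (hV.differentiableAt (by simp)).hasFDerivAt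
  obtain ⟨L, hL, e⟩ := hasFDerivAt_tautological hX hVd
  -- The form `⟨V, dX⟩` vanishes on a whole neighbourhood of `z`, so its derivative does too.
  have hL0 : L = 0 := by
    refine (hL.congr_of_eventuallyEq (f₁ := fun _ => 0) ?_).unique (hasFDerivAt_const _ _)
    filter_upwards [extChartAt_target_mem_nhds (I := 𝓡 n) q] with y hy
    exact ContinuousLinearMap.ext fun t => (hnormal y hy t).symm
  refine (Omega_dG G hq (hX.differentiableAt (by simp)) (hV.differentiableAt (by simp))
    (Filter.Eventually.of_forall fun y => (hν _).1) ?_ u w).trans ?_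
  · filter_upwards [extChartAt_source_mem_nhds (I := 𝓡 n) q] with r hr
    simp only [X, V, Function.comp_apply]
    rw [φ.left_inv hr]
    exact congrArg Subtype.val (hGν r)
  · have h0 : ∀ u w, lorentz (n + 1) (fderiv ℝ X z u) (fderiv ℝ V z w)
        - lorentz (n + 1) (fderiv ℝ V z u) (fderiv ℝ X z w) = 0 := by
      intro u w
      have h1 := e u w
      rw [hL0, lorentz_comm (fderiv ℝ V z w)] at h1
      simp only [zero_apply, sub_self] at h1
      linarith
    exact h0 _ _

/-- Locally integrable maps are Lagrangian. -/
theorem IsLocallyIntegrable.isLagrangian [IsManifold (𝓡 n) ∞ N] {G : N → GeodesicSpace (n + 1)}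
    (hG : ContMDiff (𝓡 n) 𝓘(ℝ, Minkowski (n + 1) × Minkowski (n + 1)) ∞
      (fun q => (G q : Minkowski (n + 1) × Minkowski (n + 1))))
    (h : IsLocallyIntegrable G) : IsLagrangian G := by
  intro q u w
  obtain ⟨U, hqU, o, σ, hσ, hgauss⟩ := h q
  have hL := isLagrangian_of_isGaussMap (G := fun r : U => G r)
    (fun r => contMDiffAt_subtype_iff (f := fun q : N => (G q).1).2 (hG r)) hσ hgauss
  obtain ⟨u', rfl⟩ := (bijective_mfderiv_subtype_val U ⟨q, hqU⟩).2 u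
  obtain ⟨w', rfl⟩ := (bijective_mfderiv_subtype_val U ⟨q, hqU⟩).2 w
  have key : ∀ t, dG G q (mfderiv (𝓡 n) (𝓡 n) (Subtype.val : U → N) ⟨q, hqU⟩ t)
      = dG (fun r : U => G r) ⟨q, hqU⟩ t := fun t =>
    Subtype.ext (mfderiv_comp_subtype_val U ⟨q, hqU⟩ (hG q) t).symm
  rw [key, key]
  exact hL ⟨q, hqU⟩ u' w'

/-- Lagrangian immersions are locally integrable. -/
theorem IsLagrangian.isLocallyIntegrable [IsManifold (𝓡 n) ∞ N] {G : N → GeodesicSpace (n + 1)}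
    (hG : IsImmersionG (n := n) G) (h : IsLagrangian G) : IsLocallyIntegrable G := by
  intro q
  set φ := extChartAt (𝓡 n) q with hφ
  have hq : q ∈ φ.source := mem_extChartAt_source q
  let g : EuclideanSpace ℝ (Fin n) → Minkowski (n + 1) × Minkowski (n + 1) :=
    (fun q => (G q : Minkowski (n + 1) × Minkowski (n + 1))) ∘ φ.symm
  have hg : ∀ r ∈ φ.source, ContDiffAt ℝ ∞ g (φ r) := fun r hr =>
    contDiffAt_comp_extChartAt_symm hr (hG.1 r)
  have hlift : ∀ r ∈ φ.source, ContDiffAt ℝ ∞ (fun y => unitLift (g y)) (φ r) := fun r hr =>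
    ContDiffAt.comp (g := unitLift) (f := g) (φ r)
      (contDiffAt_unitLift (G (φ.symm (φ r)))) (hg r hr)
  let X := fun y => (unitLift (g y)).1
  let V := fun y => (unitLift (g y)).2
  have hX : ∀ r ∈ φ.source, ContDiffAt ℝ ∞ X (φ r) := fun r hr => (hlift r hr).fst
  have hV : ∀ r ∈ φ.source, ContDiffAt ℝ ∞ V (φ r) := fun r hr => (hlift r hr).snd
  -- This holds even for `y` off `φ.target`: `φ.symm y` is always some point of the manifold.
  have hU : ∀ y, (X y, V y) ∈ UnitTangent (n + 1) := fun y => unitLift_mem (G (φ.symm y))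
  have hend : ∀ y, endpoints (X y, V y) = g y := fun y => endpoints_unitLift (G (φ.symm y))
  obtain ⟨ε, hε, hball⟩ := Metric.mem_nhds_iff.1 (extChartAt_target_mem_nhds (I := 𝓡 n) q)
  rw [← hφ] at hball
  set s := Metric.ball (φ q) ε with hs
  have hmem : ∀ y ∈ s, ∃ r ∈ φ.source, φ r = y := fun y hy =>
    ⟨φ.symm y, φ.map_target (hball hy), φ.right_inv (hball hy)⟩
  have hsymm : ∀ y ∈ s, ∀ u w, lorentz (n + 1) (fderiv ℝ X y u) (fderiv ℝ V y w)
      = lorentz (n + 1) (fderiv ℝ V y u) (fderiv ℝ X y w) := by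
    intro y hy u w
    obtain ⟨r, hr, rfl⟩ := hmem y hy
    obtain ⟨u, rfl⟩ := (bijective_mfderiv_extChartAt hr).2 u
    obtain ⟨w, rfl⟩ := (bijective_mfderiv_extChartAt hr).2 w
    have h1 := Omega_dG G hr ((hX r hr).differentiableAt (by simp))
      ((hV r hr).differentiableAt (by simp)) (Filter.Eventually.of_forall hU) (by
        filter_upwards [eventually_eq_comp_extChartAt hr
          (fun q => (G q : Minkowski (n + 1) × Minkowski (n + 1)))] with r' hr'
        rw [hend]
        exact hr') u w
    rw [h] at h1
    exact (sub_eq_zero.1 h1.symm)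
  have hinj : ∀ w, fderiv ℝ (endpoints (d := n + 1)) (X (φ q), V (φ q))
      (fderiv ℝ X (φ q) w, fderiv ℝ V (φ q) w) = 0 → w = 0 := by
    intro w hw
    obtain ⟨u, rfl⟩ := (bijective_mfderiv_extChartAt hq).2 w
    have hc := hasFDerivAt_endpoints_comp ((hX q hq).differentiableAt (by simp)).hasFDerivAt
      ((hV q hq).differentiableAt (by simp)).hasFDerivAt (hU (φ q))
    -- The lift projects back to `g`, so a vector killed here lies in the kernel of the differential
    -- of the immersion `G`.
    rw [funext hend] at hc
    have h1 := mfderiv_eq_fderiv_extChartAt hq (hG.1 q) u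
    have h2 : fderiv ℝ g (φ q) (mfderiv (𝓡 n) 𝓘(ℝ, EuclideanSpace ℝ (Fin n)) φ q u) = 0 := by
      rw [hc.fderiv]
      exact hw
    have h3 : u = 0 := (injective_iff_map_eq_zero _).1 (hG.2 q) u (h1.trans h2)
    rw [h3]
    exact map_zero _
  obtain ⟨X₁, V₁, hX₁, hV₁, hlift₁, hinj₁⟩ := exists_normal_lift Metric.isOpen_ball
    (convex_ball (φ q) ε)
    (fun y hy => by obtain ⟨r, hr, rfl⟩ := hmem y hy; exact (hX r hr).contDiffWithinAt)
    (fun y hy => by obtain ⟨r, hr, rfl⟩ := hmem y hy; exact (hV r hr).contDiffWithinAt)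
    (fun y _ => hU y) hsymm (Metric.mem_ball_self hε) hinj
  -- `X₁` is known to be an immersion at the centre only; injective linear maps form an open set,
  -- which yields the neighbourhood `U`.
  have hopen : IsOpen (s ∩ fderiv ℝ X₁ ⁻¹' {L | Function.Injective L}) :=
    (hX₁.continuousOn_fderiv_of_isOpen Metric.isOpen_ball (by simp)).isOpen_inter_preimage
      Metric.isOpen_ball ContinuousLinearMap.isOpen_injective
  let U : TopologicalSpace.Opens N := ⟨
    φ.source ∩ φ ⁻¹' (s ∩ fderiv ℝ X₁ ⁻¹' {L | Function.Injective L}),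
    (continuousOn_extChartAt (I := 𝓡 n) q).isOpen_inter_preimage
      (isOpen_extChartAt_source (I := 𝓡 n) q) hopen⟩
  have hUs : ∀ r : U, φ r ∈ s := fun r => r.2.2.1
  have hX₁d : ∀ r : U, ContDiffAt ℝ ∞ X₁ (φ r) := fun r =>
    hX₁.contDiffAt (Metric.isOpen_ball.mem_nhds (hUs r))
  have hX₁m : ∀ r : U, ContMDiffAt (𝓡 n) 𝓘(ℝ, Minkowski (n + 1)) ∞ (fun r => X₁ (φ r)) r.1 :=
    fun r => (hX₁d r).contMDiffAt.comp r.1 (contMDiffAt_extChartAt' (by simpa [hφ] using r.2.1))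
  have hV₁m : ∀ r : U, ContMDiffAt (𝓡 n) 𝓘(ℝ, Minkowski (n + 1)) ∞ (fun r => V₁ (φ r)) r.1 :=
    fun r => (hV₁.contDiffAt (Metric.isOpen_ball.mem_nhds (hUs r))).contMDiffAt.comp r.1
      (contMDiffAt_extChartAt' (by simpa [hφ] using r.2.1))
  let σ : U → Hyp (n + 1) := fun r => ⟨X₁ (φ r), (hlift₁ _ (hUs r)).1.1⟩
  let ν : U → Minkowski (n + 1) := fun r => V₁ (φ r)
  have hd : ∀ (r : U) (u : TangentSpace (𝓡 n) r),
      mfderiv (𝓡 n) 𝓘(ℝ, Minkowski (n + 1)) (fun q => (σ q : Minkowski (n + 1))) r u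
        = fderiv ℝ X₁ (φ r) (mfderiv (𝓡 n) 𝓘(ℝ, EuclideanSpace ℝ (Fin n)) φ r.1
          (mfderiv (𝓡 n) (𝓡 n) (Subtype.val : U → N) r u)) := fun r u =>
    (mfderiv_comp_subtype_val U r (hX₁m r) u).trans
      (mfderiv_comp_extChartAt r.2.1 ((hX₁d r).differentiableAt (by simp))
        (Filter.Eventually.of_forall fun _ => rfl) _)
  have hσ : IsImmersionHyp (n := n) σ := by
    refine ⟨fun r => contMDiffAt_subtype_iff.2 (hX₁m r), fun r => ?_⟩
    refine (injective_iff_map_eq_zero _).2 fun u hu => ?_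
    rw [hd] at hu
    have h1 := (injective_iff_map_eq_zero _).1 r.2.2.2 _ hu
    have h2 := (injective_iff_map_eq_zero _).1 (bijective_mfderiv_extChartAt r.2.1).1 _ h1
    exact (injective_iff_map_eq_zero _).1 (bijective_mfderiv_subtype_val U r).1 _ h2
  have hut : ∀ r : U, ((σ r : Minkowski (n + 1)), ν r) ∈ UnitTangent (n + 1) :=
    fun r => (hlift₁ _ (hUs r)).1
  have hnormal : ∀ (r : U) (u : TangentSpace (𝓡 n) r), lorentz (n + 1) (ν r)
      (mfderiv (𝓡 n) 𝓘(ℝ, Minkowski (n + 1)) (fun q => (σ q : Minkowski (n + 1))) r u) = 0 := by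
    intro r u
    rw [hd]
    exact (hlift₁ _ (hUs r)).2.2 _
  have htan : ∀ (r : U) (u : TangentSpace (𝓡 n) r), lorentz (n + 1) (σ r)
      (mfderiv (𝓡 n) 𝓘(ℝ, Minkowski (n + 1)) (fun q => (σ q : Minkowski (n + 1))) r u) = 0 := by
    intro r u
    rw [hd]
    have h1 := ((hX₁d r).differentiableAt (by simp)).hasFDerivAt
    -- Differentiate `⟨X₁, X₁⟩ = -1`.
    have h2 : ∀ w, lorentz (n + 1) (X₁ (φ r)) (fderiv ℝ X₁ (φ r) w) = 0 := by
      intro w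
      have h3 := lorentz_fderiv_add_eq_zero h1 h1 (c := -1)
        (Filter.eventually_of_mem (Metric.isOpen_ball.mem_nhds (hUs r))
          fun y hy => (hlift₁ y hy).1.1.1) w
      rw [lorentz_comm (fderiv ℝ X₁ (φ r) w)] at h3
      linarith
    exact h2 _
  have hne : ∀ r : U, normalForm σ r (ν r) ≠ 0 := fun r =>
    normalForm_ne_zero (hσ.2 r) (hut r) (htan r) (hnormal r)
  obtain ⟨o, ho⟩ := exists_orientation hσ.1 (ContMDiff.continuous (I := 𝓡 n)
    (I' := 𝓘(ℝ, Minkowski (n + 1))) (n := ∞) fun r => contMDiffAt_subtype_iff.2 (hV₁m r)) hne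
  refine ⟨U, ⟨hq, Metric.mem_ball_self hε, hinj₁⟩, o, σ, hσ, ν,
    fun r => ⟨hut r, hnormal r, hne r, ho r⟩, fun r => Subtype.ext ?_⟩
  refine Eq.trans ?_ ((hlift₁ _ (hUs r)).2.1.trans (hend _)).symm
  simp only [g, Function.comp_apply]
  rw [φ.left_inv r.2.1]

end Lagrangian

end HypGeod
end

theorem theoremA (n : ℕ) (M : Type*) [TopologicalSpace M]
    [ChartedSpace (EuclideanSpace ℝ (Fin n)) M] [IsManifold (𝓡 n) ∞ M]
    (G : M → HypGeod.GeodesicSpace (n + 1)) (hG : HypGeod.IsImmersionG (n := n) G) :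
    HypGeod.IsLagrangian G ↔ HypGeod.IsLocallyIntegrable G :=
  ⟨fun h => h.isLocallyIntegrable hG, fun h => h.isLagrangian hG.1⟩
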